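/- Let $n,m\ge 1$ and let $\Lambda^{(1)},\dots,\Lambda^{(m)}$ be linearly independent skew-symmetric real $n\times n$ matrices. Consider the step-two Carnot group $\mathbb G=\mathbb R^{n}\times\mathbb R^m$ with the group law $(x,z)\circ(x',z')=\bigl(x+x',\,(z_j+z_j'+\tfrac12\langle\Lambda^{(j)}x,x'\rangle)_{j=1,\dots,m}\bigr)$, the horizontal sub-gradient $\nabla=(X_1,\dots,X_n)$, where $X_i=\frac{\partial}{\partial x_i}+\frac12\sum_{k=1}^m\sum_{l=1}^n\Lambda^{(k)}_{il}x_l\frac{\partial}{\partial z_k}$, and the homogeneous norm $N(x,z)=(|x|^4+a|z|^2)^{1/4}$ with $a\in(0,\infty)$. Let $g:[0,\infty)\to[0,\infty)$ be an increasing (not necessarily strictly) differentiable function whose derivative $g'$ is differentiable on $[1,\infty)$ with $g''(t)\le g'(t)^3t^3$ for all $t\ge1$ (at $t=1$, $g''$ is the right derivative of $g'$). Let $\lambda$ be Lebesgue measure on $\mathbb R^{n+m}$, and assume that $d\mu=\frac1Z e^{-g(N)}\,d\lambda$, with $Z=\int e^{-g(N)}\,d\lambda$, is a probability measure (that is, $Z<\infty$).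 Then for every real $q\ge2$ there are constants $C,D\in(0,\infty)$ such that $$\int\frac{g'(N)}{N^2}|f|^q\,d\mu\le C\int|\nabla f|^q\,d\mu+D\int|f|^q\,d\mu$$ for every function $f:\mathbb G\to\mathbb R$ that vanishes on $\{N<1\}$ and is locally Lipschitz with respect to the Carnot–Carathéodory distance (equivalently, with respect to the homogeneous distance $N(p^{-1}\circ p')$; this includes all functions that are locally Lipschitz in the Euclidean sense). The integrals take values in $[0,\infty]$, and the constants do not depend on $f$. -/

import Mathlib

open MeasureTheory

/-- The data of a step-two Carnot group on `ℝⁿ × ℝᵐ`: skew-symmetric, linearly independent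
`n × n` matrices `Λ⁽¹⁾, …, Λ⁽ᵐ⁾`, with `m ≥ 1`. -/
structure StepTwoCarnot (n m : ℕ) where
  /-- the structure matrices -/
  Λ : Fin m → Matrix (Fin n) (Fin n) ℝ
  skew : ∀ j, (Λ j).transpose = -(Λ j)
  indep : LinearIndependent ℝ Λ
  pos : 0 < m

namespace StepTwoCarnot

/-- The underlying space `ℝⁿ × ℝᵐ`, each factor with its Euclidean norm. Its `volume` is
Lebesgue measure. -/
abbrev Space (n m : ℕ) : Type := EuclideanSpace ℝ (Fin n) × EuclideanSpace ℝ (Fin m)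

noncomputable section

variable {n m : ℕ}

/-- The group law `(x, z) ∘ (x', z') = (x + x', z_j + z'_j + ½ ⟨Λ⁽ʲ⁾ x, x'⟩)`. -/
def op (G : StepTwoCarnot n m) (p p' : Space n m) : Space n m :=
  (p.1 + p'.1,
    WithLp.toLp 2 fun j => p.2 j + p'.2 j + (1 / 2) * ∑ i, (∑ l, G.Λ j i l * p.1 l) * p'.1 i)

/-- The homogeneous norm `N(x, z) = (|x|⁴ + a |z|²)^{1/4}`. -/
def gauge (a : ℝ) (p : Space n m) : ℝ :=
  (‖p.1‖ ^ 4 + a * ‖p.2‖ ^ 2) ^ ((1 : ℝ) / 4)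

/-- The value at `p = (x, z)` of the left-invariant vector field
`X_i = ∂/∂x_i + ½ ∑_k ∑_l Λ⁽ᵏ⁾_{il} x_l ∂/∂z_k`. -/
def field (G : StepTwoCarnot n m) (i : Fin n) (p : Space n m) : Space n m :=
  (EuclideanSpace.single i 1, WithLp.toLp 2 fun k => (1 / 2) * ∑ l, G.Λ k i l * p.1 l)

/-- The integral curve of `X_i` through `p` is the straight line `s ↦ p ∘ (s e_i, 0)`; hence
`X_i f (p)` is the line derivative of `f` at `p` in the direction `G.field i p`. -/
theorem op_single (G : StepTwoCarnot n m) (i : Fin n) (p : Space n m) (s : ℝ) :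
    G.op p (EuclideanSpace.single i s, 0) = p + s • G.field i p := by
  ext j
  · simp [op, field]
  · simp [op, field]
    ring

/-- The horizontal sub-gradient `∇f = (X_1 f, …, X_n f)`. -/
def subgradient (G : StepTwoCarnot n m) (f : Space n m → ℝ) (p : Space n m) :
    EuclideanSpace ℝ (Fin n) :=
  WithLp.toLp 2 fun i => lineDeriv ℝ f p (G.field i p)

/-- `f` is locally Lipschitz on the group for the left-invariant homogeneous (quasi-)distance
`N(p⁻¹ ∘ p')`, where `p⁻¹ = -p`. That distance is bi-Lipschitz equivalent to the
Carnot–Carathéodory distance; functions that are locally Lipschitz for the Euclidean distance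
are locally Lipschitz in this sense. -/
def LocLipschitz (G : StepTwoCarnot n m) (a : ℝ) (f : Space n m → ℝ) : Prop :=
  ∀ p, ∃ K : ℝ, ∃ U ∈ nhds p, ∀ u ∈ U, ∀ v ∈ U, |f u - f v| ≤ K * gauge a (G.op (-u) v)

/-- The measure `dμ = Z⁻¹ e^{-g(N)} dλ` with `Z = ∫ e^{-g(N)} dλ`. (It is a probability measure
exactly if `e^{-g(N)}` is integrable.) -/
def gibbs (n m : ℕ) (a : ℝ) (g : ℝ → ℝ) : Measure (Space n m) :=
  volume.withDensity fun p =>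
    ENNReal.ofReal (Real.exp (-g (gauge a p)) / ∫ p' : Space n m, Real.exp (-g (gauge a p')))

end

end StepTwoCarnot

/-!
Work on the unit gauge ball `{N < 1}` and write `Λ(z) = ∑ₖ z_k Λ⁽ᵏ⁾`. The Euler field `x` has
divergence `n`, and its flux through the gauge sphere degenerates only at `x = 0`. Near there it is
corrected by the field `σ⁻² (σ + 3 (1 - N⁴)) Λ(z) x - K σ⁻¹ Λ(z)ᵀ Λ(z) x`, where
`σ = |Λ(z) x|² + 1 - N⁴`. Its divergence is at most `12 a - a / (2 σ)`, which absorbs the square of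
the field, of order `1 / σ`.
Hence the corrected field `W` satisfies `div W + ε |W|² ≤ D`, while its flux through `{N = ρ}` stays
bounded below as `ρ → 1`, except at the characteristic points, which form a null set.

Truncating `W` by a cutoff of `N⁴`, integrating its divergence against `|f|^q` and using Young's
inequality bounds the integral of `|f|^q` over a collar of the sphere by the integral of
`C |∇f|^q + D |f|^q` over the ball. Dilate this to the balls `{N < t}` and average over `t > 1` with
the density `g'(t) e^{-g(t)}`: the right-hand sides add up to at most the integral against
`e^{-g(N)}`, and when the cutoffs sharpen the collars add up to `g'(N) e^{-g(N)} |f|^q / (4 N)`.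
-/

open Filter Metric Topology
open scoped Matrix

/-- Local Lipschitz continuity of `F` along the lines `s ↦ q + s • w q`. For `w = G.field i`, whose
integral curves are these lines, it is the regularity in the direction `X_i` that integration by
parts needs. -/
def LocLipAlong {E : Type*} [AddCommGroup E] [Module ℝ E] [TopologicalSpace E] (w : E → E)
    (F : E → ℝ) : Prop :=
  ∀ p, ∃ K : ℝ, ∃ U ∈ 𝓝 p, ∀ q ∈ U, ∀ s : ℝ, q + s • w q ∈ U →
    |F (q + s • w q) - F q| ≤ K * |s|

theorem ae_differentiableAt_of_locallyLipschitz {φ : ℝ → ℝ} (hφ : LocallyLipschitz φ) :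
    ∀ᵐ t, DifferentiableAt ℝ φ t := by
  have on_Icc (N : ℕ) : ∀ᵐ t, t ∈ Set.Icc (-(N : ℝ)) N →
      DifferentiableWithinAt ℝ φ (Set.Icc (-(N : ℝ)) N) t := by
    obtain ⟨K, hK⟩ := LocallyLipschitzOn.exists_lipschitzOnWith_of_compact isCompact_Icc
      (hφ.locallyLipschitzOn (s := Set.Icc (-(N : ℝ)) N))
    exact hK.ae_differentiableWithinAt_of_mem_real
  filter_upwards [ae_all_iff.2 on_Icc] with t ht
  obtain ⟨N, hN⟩ := exists_nat_gt |t|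
  have htN := abs_lt.1 hN
  exact (ht N ⟨htN.1.le, htN.2.le⟩).differentiableAt (Icc_mem_nhds htN.1 htN.2)

namespace LocLipAlong

section Algebra

variable {E : Type*} [AddCommGroup E] [Module ℝ E] [TopologicalSpace E] {F F' : E → ℝ} {w : E → E}

theorem mul (hF : LocLipAlong w F) (hF' : LocLipAlong w F') (cF : Continuous F)
    (cF' : Continuous F') : LocLipAlong w fun p => F p * F' p := by
  intro p
  obtain ⟨K, U, hU, hK⟩ := hF p
  obtain ⟨K', U', hU', hK'⟩ := hF' p
  have near_F : ∀ᶠ q in 𝓝 p, |F q| < |F p| + 1 := cF.abs.continuousAt.eventually_lt_const (by simp)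
  have near_F' : ∀ᶠ q in 𝓝 p, |F' q| < |F' p| + 1 :=
    cF'.abs.continuousAt.eventually_lt_const (by simp)
  refine ⟨(|F p| + 1) * K' + (|F' p| + 1) * K, _,
    (eventually_mem_set.2 hU).and <| (eventually_mem_set.2 hU').and <| near_F.and near_F', ?_⟩
  rintro q ⟨hq, hq', -, hqF'⟩ s ⟨hs, hs', hsF, -⟩
  have lip := hK q hq s hs
  have lip' := hK' q hq' s hs'
  calc |F (q + s • w q) * F' (q + s • w q) - F q * F' q|
      = |F (q + s • w q) * (F' (q + s • w q) - F' q) + F' q * (F (q + s • w q) - F q)| := by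
        congr 1; ring
    _ ≤ |F (q + s • w q)| * |F' (q + s • w q) - F' q| + |F' q| * |F (q + s • w q) - F q| := by
        rw [← abs_mul, ← abs_mul]; exact abs_add_le _ _
    _ ≤ (|F p| + 1) * (K' * |s|) + (|F' p| + 1) * (K * |s|) := by gcongr
    _ = _ := by ring

theorem comp (hF : LocLipAlong w F) (cF : Continuous F) {φ : ℝ → ℝ} (hφ : LocallyLipschitz φ) :
    LocLipAlong w fun p => φ (F p) := by
  intro p
  obtain ⟨K, U, hU, hK⟩ := hF p
  obtain ⟨C, T, hT, hC⟩ := hφ (F p)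
  refine ⟨C * K, U ∩ F ⁻¹' T, inter_mem hU (cF.continuousAt.preimage_mem_nhds hT), ?_⟩
  rintro q ⟨hqU, hqT⟩ s ⟨hsU, hsT⟩
  calc |φ (F (q + s • w q)) - φ (F q)|
      ≤ C * |F (q + s • w q) - F q| := by
        simpa only [Real.dist_eq] using hC.dist_le_mul _ hsT _ hqT
    _ ≤ C * (K * |s|) := by gcongr; exact hK q hqU s hsU
    _ = C * K * |s| := (mul_assoc ..).symm

end Algebra

section Normed

variable {E : Type*} [NormedAddCommGroup E] [NormedSpace ℝ E] {F : E → ℝ} {v : E} {w : E → E}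

theorem of_locallyLipschitz (hF : LocallyLipschitz F) (hw : Continuous w) : LocLipAlong w F := by
  intro p
  obtain ⟨K, U, hU, hK⟩ := hF p
  have near_w : ∀ᶠ q in 𝓝 p, ‖w q‖ < ‖w p‖ + 1 :=
    hw.norm.continuousAt.eventually_lt_const (by simp)
  refine ⟨K * (‖w p‖ + 1), _, (eventually_mem_set.2 hU).and near_w, ?_⟩
  rintro q ⟨hqU, hqw⟩ s ⟨hsU, -⟩
  calc |F (q + s • w q) - F q|
      ≤ K * ‖s • w q‖ := by
        simpa only [dist_eq_norm, add_sub_cancel_left, Real.norm_eq_abs]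
          using hK.dist_le_mul _ hsU _ hqU
    _ ≤ K * ((‖w p‖ + 1) * |s|) := by
        rw [norm_smul, Real.norm_eq_abs, mul_comm |s|]; gcongr
    _ = K * (‖w p‖ + 1) * |s| := (mul_assoc ..).symm

theorem locallyLipschitz_line (h : LocLipAlong (fun _ => v) F) (p : E) :
    LocallyLipschitz fun t : ℝ => F (p + t • v) := by
  intro t₀
  obtain ⟨K, U, hU, hK⟩ := h (p + t₀ • v)
  refine ⟨K.toNNReal, (fun t : ℝ => p + t • v) ⁻¹' U,
    (Continuous.continuousAt (by fun_prop)).preimage_mem_nhds hU,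
    LipschitzOnWith.of_dist_le_mul fun x hx y hy => ?_⟩
  have along : p + y • v + (x - y) • v = p + x • v := by module
  have lip := hK _ hy (x - y) (by rwa [along])
  rw [along] at lip
  rw [Real.dist_eq, Real.dist_eq]
  exact lip.trans (mul_le_mul_of_nonneg_right (Real.le_coe_toNNReal K) (abs_nonneg _))

theorem uniform_on_compact (h : LocLipAlong (fun _ => v) F) {S : Set E} (hS : IsCompact S) :
    ∃ K : ℝ, ∃ r > 0, ∀ x ∈ S, ∀ t : ℝ, |t| ≤ r → |F (x + t • v) - F x| ≤ K * |t| := by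
  refine hS.induction_on ⟨0, 1, one_pos, by simp⟩ ?_ ?_ fun p _ => ?_
  · rintro s t hst ⟨K, r, hr, h⟩
    exact ⟨K, r, hr, fun x hx => h x (hst hx)⟩
  · rintro s t ⟨K, r, hr, h⟩ ⟨K', r', hr', h'⟩
    refine ⟨max K K', min r r', lt_min hr hr', ?_⟩
    rintro x (hx | hx) t ht
    · exact (h x hx t (ht.trans (min_le_left _ _))).trans (by gcongr; exact le_max_left _ _)
    · exact (h' x hx t (ht.trans (min_le_right _ _))).trans (by gcongr; exact le_max_right _ _)
  · obtain ⟨K, U, hU, hK⟩ := h p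
    have cont : Tendsto (fun y : E × ℝ => y.1 + y.2 • v) (𝓝 p ×ˢ 𝓝 0) (𝓝 p) := by
      rw [← nhds_prod_eq]
      exact Continuous.tendsto' (by fun_prop) _ _ (by simp)
    obtain ⟨V, hV, W, hW, hVW⟩ := mem_prod_iff.1 (cont hU)
    obtain ⟨r, hr, hrW⟩ := nhds_basis_closedBall.mem_iff.1 hW
    refine ⟨U ∩ V, mem_nhdsWithin_of_mem_nhds (inter_mem hU hV), K, r, hr, fun x hx t ht => ?_⟩
    exact hK x hx.1 t (hVW (Set.mk_mem_prod hx.2 (hrW (by simpa using ht))))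

variable [FiniteDimensional ℝ E] [MeasurableSpace E] [BorelSpace E] {μ : Measure E}
  [μ.IsAddHaarMeasure]

theorem ae_lineDifferentiableAt (h : LocLipAlong (fun _ => v) F) (cF : Continuous F) :
    ∀ᵐ p ∂μ, LineDifferentiableAt ℝ F p v := by
  let L : ℝ →L[ℝ] E := ContinuousLinearMap.smulRight (1 : ℝ →L[ℝ] ℝ) v
  refine ae_mem_of_ae_add_linearMap_mem L.toLinearMap volume μ
    (measurableSet_lineDifferentiableAt cF) fun p => ?_
  filter_upwards [ae_differentiableAt_of_locallyLipschitz (h.locallyLipschitz_line p)] with s hs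
  have diff : DifferentiableAt ℝ (fun t : ℝ => F (p + (s + t) • v)) 0 :=
    DifferentiableAt.comp (g := fun t : ℝ => F (p + t • v)) 0 (by simpa using hs)
      (differentiableAt_id.const_add s)
  have line (t : ℝ) : p + (s + t) • v = p + s • v + t • v := by module
  simpa only [line] using! diff

theorem exists_integrable_bound_slope (h : LocLipAlong (fun _ => v) F)
    (sF : HasCompactSupport F) :
    ∃ b : E → ℝ, Integrable b μ ∧
      ∀ᶠ t : ℝ in 𝓝[>] 0, ∀ x, ‖t⁻¹ • (F (x + t • v) - F x)‖ ≤ b x := by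
  have hS : IsCompact (cthickening ‖v‖ (tsupport F)) := IsCompact.cthickening sF
  set S := cthickening ‖v‖ (tsupport F)
  obtain ⟨K, r, hr, hK⟩ := h.uniform_on_compact hS
  refine ⟨S.indicator fun _ => |K|, (integrable_indicator_iff hS.measurableSet).2
    (continuousOn_const.integrableOn_compact hS), ?_⟩
  filter_upwards [Ioc_mem_nhdsGT (lt_min hr one_pos)] with t ⟨t_pos, ht⟩ x
  by_cases hx : x ∈ S
  · rw [Set.indicator_of_mem hx, norm_smul, norm_inv, inv_mul_le_iff₀ (norm_pos_iff.2 t_pos.ne'),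
      Real.norm_eq_abs, Real.norm_eq_abs, mul_comm]
    refine (hK x hx t ?_).trans (by gcongr; exact le_abs_self K)
    exact (abs_of_pos t_pos).trans_le (ht.trans (min_le_left _ _))
  · have zero : F x = 0 := by
      contrapose! hx
      exact self_subset_cthickening _ (subset_tsupport _ hx)
    have zero_add : F (x + t • v) = 0 := by
      contrapose! hx
      refine mem_cthickening_of_dist_le _ _ _ _ (subset_tsupport _ hx) ?_
      rw [dist_eq_norm, sub_add_cancel_left, norm_neg, norm_smul, Real.norm_of_nonneg t_pos.le]
      exact mul_le_of_le_one_left (norm_nonneg v) (ht.trans (min_le_right _ _))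
    simp [zero, zero_add, hx]

theorem integral_lineDeriv_eq_zero (h : LocLipAlong (fun _ => v) F) (cF : Continuous F)
    (sF : HasCompactSupport F) :
    Integrable (fun x => lineDeriv ℝ F x v) μ ∧ ∫ x, lineDeriv ℝ F x v ∂μ = 0 := by
  obtain ⟨b, hb, bound⟩ := h.exists_integrable_bound_slope (μ := μ) sF
  have lim : ∀ᵐ x ∂μ, Tendsto (fun t : ℝ => t⁻¹ • (F (x + t • v) - F x)) (𝓝[>] 0)
      (𝓝 (lineDeriv ℝ F x v)) := by
    filter_upwards [h.ae_lineDifferentiableAt cF] with x hx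
    exact hx.hasLineDerivAt.tendsto_slope_zero_right
  have integral_slope (t : ℝ) : ∫ x, t⁻¹ • (F (x + t • v) - F x) ∂μ = 0 := by
    have iF : Integrable F μ := cF.integrable_of_hasCompactSupport sF
    rw [integral_smul, integral_sub (iF.comp_add_right (t • v)) iF,
      integral_add_right_eq_self F (t • v), sub_self, smul_zero]
  have lim_integral := tendsto_integral_filter_of_dominated_convergence b
    (.of_forall fun t => Continuous.aestronglyMeasurable (by fun_prop))
    (bound.mono fun t ht => .of_forall ht) hb lim
  simp only [integral_slope] at lim_integral
  refine ⟨hb.mono' (aestronglyMeasurable_lineDeriv cF μ) ?_,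
    tendsto_nhds_unique lim_integral tendsto_const_nhds⟩
  filter_upwards [lim] with x hx
  exact le_of_tendsto hx.norm (bound.mono fun t ht => ht x)

end Normed

end LocLipAlong

namespace StepTwoCarnot

variable {n m : ℕ} (G : StepTwoCarnot n m)

section Straighten

instance : (volume : Measure (Space n m)).IsAddHaarMeasure :=
  Measure.prod.instIsAddHaarMeasure volume volume

theorem skew_apply (k : Fin m) (i j : Fin n) : G.Λ k i j = -G.Λ k j i := by
  simpa using congrFun (congrFun (G.skew k) j) i

theorem diag_eq_zero (k : Fin m) (i : Fin n) : G.Λ k i i = 0 := by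
  linarith [G.skew_apply k i i]

@[fun_prop]
theorem contDiff_field {r : WithTop ℕ∞} (i : Fin n) : ContDiff ℝ r (G.field i) := by
  unfold field
  fun_prop

/-- The shear of the vertical directions that maps the lines parallel to the `i`-th coordinate axis
to the integral curves of `X_i`. It preserves Lebesgue measure. -/
noncomputable def straighten (i : Fin n) : Space n m ≃ₜ Space n m where
  toFun p := (p.1, p.2 + WithLp.toLp 2 fun k => (1 / 2) * p.1 i * ∑ l, G.Λ k i l * p.1 l)
  invFun p := (p.1, p.2 - WithLp.toLp 2 fun k => (1 / 2) * p.1 i * ∑ l, G.Λ k i l * p.1 l)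
  left_inv p := by simp
  right_inv p := by simp
  continuous_toFun := by fun_prop
  continuous_invFun := by fun_prop

theorem straighten_add (i : Fin n) (p : Space n m) (s : ℝ) :
    G.straighten i (p + s • (EuclideanSpace.single i 1, 0)) =
      G.straighten i p + s • G.field i (G.straighten i p) := by
  ext j
  · simp [straighten, field]
  · simp [straighten, field, mul_add, Finset.sum_add_distrib, G.diag_eq_zero]
    ring

theorem measurePreserving_straighten (i : Fin n) :
    MeasurePreserving (G.straighten i) volume volume := by
  refine MeasurePreserving.skew_product (g := fun (x : EuclideanSpace ℝ (Fin n)) z =>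
      z + WithLp.toLp 2 fun k => (1 / 2) * x i * ∑ l, G.Λ k i l * x l)
    (MeasurePreserving.id volume) ?_ (.of_forall fun x => map_add_right_eq_self _ _)
  exact Continuous.measurable (by unfold Function.uncurry; fun_prop)

variable {G} {F : Space n m → ℝ} {i : Fin n}

theorem locLipAlong_comp_straighten (hF : LocLipAlong (G.field i) F) :
    LocLipAlong (fun _ => (EuclideanSpace.single i 1, 0)) (F ∘ G.straighten i) := by
  intro p
  obtain ⟨K, U, hU, hK⟩ := hF (G.straighten i p)
  refine ⟨K, G.straighten i ⁻¹' U,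
    (G.straighten i).continuous.continuousAt.preimage_mem_nhds hU, fun q hq s hs => ?_⟩
  rw [Set.mem_preimage, straighten_add] at hs
  simpa only [Function.comp_apply, straighten_add] using hK _ hq s hs

theorem lineDifferentiableAt_comp_straighten (p : Space n m) :
    LineDifferentiableAt ℝ (F ∘ G.straighten i) p (EuclideanSpace.single i 1, 0) ↔
      LineDifferentiableAt ℝ F (G.straighten i p) (G.field i (G.straighten i p)) := by
  simp only [LineDifferentiableAt, Function.comp_apply, straighten_add]

theorem lineDeriv_comp_straighten (p : Space n m) :
    lineDeriv ℝ (F ∘ G.straighten i) p (EuclideanSpace.single i 1, 0) =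
      lineDeriv ℝ F (G.straighten i p) (G.field i (G.straighten i p)) := by
  simp only [lineDeriv, Function.comp_apply, straighten_add]

theorem ae_lineDifferentiableAt_field (hF : LocLipAlong (G.field i) F) (cF : Continuous F) :
    ∀ᵐ p, LineDifferentiableAt ℝ F p (G.field i p) := by
  have ae_comp := (locLipAlong_comp_straighten hF).ae_lineDifferentiableAt
    (μ := (volume : Measure (Space n m))) (cF.comp (G.straighten i).continuous)
  simp only [lineDifferentiableAt_comp_straighten] at ae_comp
  filter_upwards [((G.measurePreserving_straighten i).symm
    (G.straighten i).toMeasurableEquiv).quasiMeasurePreserving.ae ae_comp] with p hp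
  simpa using hp

theorem integral_lineDeriv_field (hF : LocLipAlong (G.field i) F) (cF : Continuous F)
    (sF : HasCompactSupport F) :
    Integrable (fun p => lineDeriv ℝ F p (G.field i p)) ∧
      ∫ p, lineDeriv ℝ F p (G.field i p) = 0 := by
  have h := (locLipAlong_comp_straighten hF).integral_lineDeriv_eq_zero
    (μ := (volume : Measure (Space n m))) (cF.comp (G.straighten i).continuous)
    (sF.comp_homeomorph (G.straighten i))
  simp only [lineDeriv_comp_straighten] at h
  have mp := G.measurePreserving_straighten i
  have me := (G.straighten i).measurableEmbedding
  exact ⟨(mp.integrable_comp_emb me).1 h.1, (mp.integral_comp me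
    fun p => lineDeriv ℝ F p (G.field i p)) ▸ h.2⟩

end Straighten

/-- `F'` is the horizontal gradient `(X_1 F, …, X_n F)` of `F` at `p`. -/
def HasHorGradAt (F : Space n m → ℝ) (F' : Fin n → ℝ) (p : Space n m) : Prop :=
  ∀ i, HasLineDerivAt ℝ F (F' i) p (G.field i p)

/-- `J` is the horizontal Jacobian matrix `J i j = X_i V_j` at `p` of the horizontal vector field
`∑ j, V_j X_j`. -/
def HasHorJacAt (V : Space n m → Fin n → ℝ) (J : Matrix (Fin n) (Fin n) ℝ) (p : Space n m) : Prop :=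
  ∀ i, HasLineDerivAt ℝ V (J i) p (G.field i p)

/-- `d` is the horizontal divergence `∑ j, X_j V_j` at `p` of the horizontal vector field
`∑ j, V_j X_j`. -/
def HasHorDivAt (V : Space n m → Fin n → ℝ) (d : ℝ) (p : Space n m) : Prop :=
  ∃ J, G.HasHorJacAt V J p ∧ J.trace = d

section Rules

variable {G} {F H : Space n m → ℝ} {F' H' : Fin n → ℝ} {V W : Space n m → Fin n → ℝ}
  {J K : Matrix (Fin n) (Fin n) ℝ} {d e : ℝ} {p : Space n m}

theorem HasHorGradAt.add (hF : G.HasHorGradAt F F' p) (hH : G.HasHorGradAt H H' p) :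
    G.HasHorGradAt (fun q => F q + H q) (F' + H') p :=
  fun i => HasDerivAt.add (hF i) (hH i)

theorem HasHorGradAt.const_sub (c : ℝ) (hF : G.HasHorGradAt F F' p) :
    G.HasHorGradAt (fun q => c - F q) (-F') p :=
  fun i => HasDerivAt.const_sub c (hF i)

theorem HasHorGradAt.const_mul (c : ℝ) (hF : G.HasHorGradAt F F' p) :
    G.HasHorGradAt (fun q => c * F q) (c • F') p :=
  fun i => HasDerivAt.const_mul c (hF i)

theorem HasHorGradAt.mul (hF : G.HasHorGradAt F F' p) (hH : G.HasHorGradAt H H' p) :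
    G.HasHorGradAt (fun q => F q * H q) (H p • F' + F p • H') p := by
  intro i
  have h := HasDerivAt.mul (hF i) (hH i)
  simpa only [zero_smul, add_zero, mul_comm (F' i)] using! h

theorem HasHorGradAt.sum {ι : Type*} {s : Finset ι} {F : ι → Space n m → ℝ}
    {F' : ι → Fin n → ℝ} (hF : ∀ k ∈ s, G.HasHorGradAt (F k) (F' k) p) :
    G.HasHorGradAt (fun q => ∑ k ∈ s, F k q) (∑ k ∈ s, F' k) p := by
  intro i
  rw [Finset.sum_apply]
  exact HasDerivAt.fun_sum fun k hk => hF k hk i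

theorem HasHorGradAt.comp {φ : ℝ → ℝ} {φ' : ℝ} (hφ : HasDerivAt φ φ' (F p))
    (hF : G.HasHorGradAt F F' p) : G.HasHorGradAt (fun q => φ (F q)) (φ' • F') p :=
  fun i => HasDerivAt.comp (0 : ℝ) (by simpa using hφ) (hF i)

theorem HasHorGradAt.div (hF : G.HasHorGradAt F F' p) (hH : G.HasHorGradAt H H' p)
    (h0 : H p ≠ 0) :
    G.HasHorGradAt (fun q => F q / H q) ((1 / H p) • F' - (F p / H p ^ 2) • H') p := by
  simp only [div_eq_mul_inv]
  convert hF.mul (hH.comp (hasDerivAt_inv h0)) using 1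
  rw [smul_smul, sub_eq_add_neg, ← neg_smul, one_mul, mul_neg]

theorem HasHorJacAt.dotProduct (hV : G.HasHorJacAt V J p) (hW : G.HasHorJacAt W K p) :
    G.HasHorGradAt (fun q => V q ⬝ᵥ W q) (J *ᵥ W p + K *ᵥ V p) p := by
  intro i
  have h := HasDerivAt.fun_sum fun j (_ : j ∈ Finset.univ) =>
    HasDerivAt.mul (hasDerivAt_pi.1 (hV i) j) (hasDerivAt_pi.1 (hW i) j)
  simpa only [zero_smul, add_zero, Finset.sum_add_distrib, mul_comm (V p _)] using! h

theorem HasHorJacAt.add (hV : G.HasHorJacAt V J p) (hW : G.HasHorJacAt W K p) :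
    G.HasHorJacAt (fun q => V q + W q) (J + K) p :=
  fun i => HasDerivAt.add (hV i) (hW i)

theorem HasHorJacAt.smul (hV : G.HasHorJacAt V J p) (hF : G.HasHorGradAt F F' p) :
    G.HasHorJacAt (fun q => F q • V q) (Matrix.vecMulVec F' (V p) + F p • J) p := by
  intro i
  have h := HasDerivAt.smul (hF i) (hV i)
  rw [add_comm] at h
  simpa only [zero_smul, add_zero] using! h

theorem HasHorJacAt.sum {ι : Type*} {s : Finset ι} {V : ι → Space n m → Fin n → ℝ}
    {J : ι → Matrix (Fin n) (Fin n) ℝ} (hV : ∀ k ∈ s, G.HasHorJacAt (V k) (J k) p) :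
    G.HasHorJacAt (fun q => ∑ k ∈ s, V k q) (∑ k ∈ s, J k) p := by
  intro i
  have h := HasDerivAt.fun_sum fun k hk => hV k hk i
  rwa [← Finset.sum_apply i s fun k => J k] at h

theorem HasHorJacAt.mulVec (A : Matrix (Fin n) (Fin n) ℝ) (hV : G.HasHorJacAt V J p) :
    G.HasHorJacAt (fun q => A *ᵥ V q) (J * Aᵀ) p := by
  intro i
  rw [Matrix.mul_apply_eq_vecMul, Matrix.vecMul_transpose]
  exact (A.mulVecLin.toContinuousLinearMap).hasFDerivAt.comp_hasDerivAt (0 : ℝ) (hV i)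

theorem HasHorDivAt.add (hV : G.HasHorDivAt V d p) (hW : G.HasHorDivAt W e p) :
    G.HasHorDivAt (fun q => V q + W q) (d + e) p := by
  obtain ⟨J, hJ, rfl⟩ := hV
  obtain ⟨K, hK, rfl⟩ := hW
  exact ⟨J + K, hJ.add hK, Matrix.trace_add J K⟩

theorem HasHorDivAt.smul (hV : G.HasHorDivAt V d p) (hF : G.HasHorGradAt F F' p) :
    G.HasHorDivAt (fun q => F q • V q) (F' ⬝ᵥ V p + F p * d) p := by
  obtain ⟨J, hJ, rfl⟩ := hV
  refine ⟨_, hJ.smul hF, ?_⟩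
  rw [Matrix.trace_add, Matrix.trace_vecMulVec, Matrix.trace_smul, smul_eq_mul]

theorem HasHorDivAt.const_smul (c : ℝ) (hV : G.HasHorDivAt V d p) :
    G.HasHorDivAt (fun q => c • V q) (c * d) p := by
  obtain ⟨J, hJ, rfl⟩ := hV
  exact ⟨c • J, fun i => HasDerivAt.fun_const_smul c (hJ i), Matrix.trace_smul c J⟩

end Rules

section Invariants

/-- The vector `Λ⁽ᵏ⁾ x`, twice the `z_k`-components of `X_1, …, X_n` at `p = (x, z)`. -/
noncomputable def twist (k : Fin m) (p : Space n m) : Fin n → ℝ := G.Λ k *ᵥ p.1.ofLp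

/-- The matrix `Λ(z) = ∑ₖ z_k Λ⁽ᵏ⁾` at `p = (x, z)`. -/
noncomputable def pencil (p : Space n m) : Matrix (Fin n) (Fin n) ℝ := ∑ k, p.2 k • G.Λ k

/-- The vector `Λ(z) x`, up to a scalar the vertical part of the horizontal gradient of `N⁴`. -/
noncomputable def rot (p : Space n m) : Fin n → ℝ := G.pencil p *ᵥ p.1.ofLp

/-- The vector `Λ(z)ᵀ Λ(z) x`. -/
noncomputable def rot2 (p : Space n m) : Fin n → ℝ := (G.pencil p)ᵀ *ᵥ G.rot p

/-- `|x|²` at `p = (x, z)`. -/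
noncomputable def horSq (p : Space n m) : ℝ := p.1.ofLp ⬝ᵥ p.1.ofLp

/-- `|Λ(z) x|²` at `p = (x, z)`. -/
noncomputable def rotSq (p : Space n m) : ℝ := G.rot p ⬝ᵥ G.rot p

/-- `∑ₖ |Λ⁽ᵏ⁾ x|²` at `p = (x, z)`. -/
noncomputable def twistSq (p : Space n m) : ℝ := ∑ k, G.twist k p ⬝ᵥ G.twist k p

/-- The squared Frobenius norm of `Λ(z)` at `p = (x, z)`. -/
noncomputable def frobSq (p : Space n m) : ℝ := ∑ i, ∑ j, G.pencil p i j ^ 2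

/-- The sum of the squared Frobenius norms of the structure matrices. -/
noncomputable def totalSq : ℝ := ∑ k, ∑ i, ∑ j, G.Λ k i j ^ 2

/-- The fourth power `|x|⁴ + a |z|²` of the gauge. -/
noncomputable def gaugeFour (a : ℝ) (p : Space n m) : ℝ :=
  horSq p ^ 2 + a * (p.2.ofLp ⬝ᵥ p.2.ofLp)

/-- The horizontal gradient of `gaugeFour`. -/
noncomputable def gaugeFourGrad (a : ℝ) (p : Space n m) : Fin n → ℝ :=
  (4 * horSq p) • p.1.ofLp + a • G.rot p

/-- The horizontal gradient of `rotSq`. -/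
noncomputable def rotSqGrad (p : Space n m) : Fin n → ℝ :=
  (2 : ℝ) • G.rot2 p + ∑ k, (G.twist k p ⬝ᵥ G.rot p) • G.twist k p

theorem rot_eq_sum (p : Space n m) : G.rot p = ∑ k, p.2 k • G.twist k p := by
  simp only [rot, twist, pencil, Matrix.sum_mulVec, Matrix.smul_mulVec]

theorem rot2_eq_sum (p : Space n m) : G.rot2 p = ∑ k, p.2 k • ((G.Λ k)ᵀ *ᵥ G.rot p) := by
  simp only [rot2, pencil, Matrix.transpose_sum, Matrix.transpose_smul, Matrix.sum_mulVec,
    Matrix.smul_mulVec]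

end Invariants

section Derivatives

variable (p : Space n m)

theorem hasHorJacAt_fst : G.HasHorJacAt (fun q => q.1.ofLp) 1 p := by
  refine fun i => hasDerivAt_pi.2 fun l => ?_
  have h := ((hasDerivAt_id (0 : ℝ)).mul_const ((1 : Matrix _ _ ℝ) i l)).const_add (p.1 l)
  simpa [field, Matrix.one_apply, eq_comm] using! h

theorem hasHorGradAt_snd (k : Fin m) :
    G.HasHorGradAt (fun q => q.2 k) ((1 / 2 : ℝ) • G.twist k p) p := by
  intro i
  have h := ((hasDerivAt_id (0 : ℝ)).mul_const ((1 / 2 : ℝ) * G.twist k p i)).const_add (p.2 k)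
  simpa only [one_mul] using! h

theorem hasHorJacAt_twist (k : Fin m) : G.HasHorJacAt (G.twist k) (G.Λ k)ᵀ p := by
  simpa only [one_mul] using! (G.hasHorJacAt_fst p).mulVec (G.Λ k)

theorem hasHorJacAt_rot :
    G.HasHorJacAt G.rot ((1 / 2 : ℝ) • ∑ k, Matrix.vecMulVec (G.twist k p) (G.twist k p) +
      (G.pencil p)ᵀ) p := by
  rw [funext G.rot_eq_sum]
  convert HasHorJacAt.sum fun k _ => (G.hasHorJacAt_twist p k).smul (G.hasHorGradAt_snd p k) using 1
  simp only [Matrix.smul_vecMulVec, Finset.sum_add_distrib, Finset.smul_sum, pencil,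
    Matrix.transpose_sum, Matrix.transpose_smul]

theorem hasHorGradAt_horSq : G.HasHorGradAt horSq ((2 : ℝ) • p.1.ofLp) p := by
  have h := (G.hasHorJacAt_fst p).dotProduct (G.hasHorJacAt_fst p)
  simpa only [Matrix.one_mulVec, ← two_smul ℝ] using! h

theorem hasHorGradAt_rotSq : G.HasHorGradAt G.rotSq (G.rotSqGrad p) p := by
  convert! (G.hasHorJacAt_rot p).dotProduct (G.hasHorJacAt_rot p) using 1
  rw [← two_smul ℝ, Matrix.add_mulVec, Matrix.smul_mulVec, Matrix.sum_mulVec, smul_add, smul_smul,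
    rotSqGrad, rot2]
  simp [Matrix.vecMulVec_mulVec, add_comm]

theorem hasHorGradAt_gaugeFour (a : ℝ) :
    G.HasHorGradAt (gaugeFour a) (G.gaugeFourGrad a p) p := by
  have vert : G.HasHorGradAt (fun q => q.2.ofLp ⬝ᵥ q.2.ofLp) (G.rot p) p := by
    rw [rot_eq_sum]
    convert! HasHorGradAt.sum fun k _ =>
      (G.hasHorGradAt_snd p k).mul (G.hasHorGradAt_snd p k) using 2 with k
    module
  convert! ((G.hasHorGradAt_horSq p).comp (φ := fun s => s ^ 2)
    (hasDerivAt_pow 2 _)).add (vert.const_mul a) using 2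
  rw [gaugeFourGrad, smul_smul]
  norm_num
  ring_nf

end Derivatives

end StepTwoCarnot

section SkewMatrices

variable {ι : Type*} [Fintype ι]

theorem dotProduct_self_nonneg (u : ι → ℝ) : 0 ≤ u ⬝ᵥ u :=
  Finset.sum_nonneg fun _ _ => mul_self_nonneg _

theorem norm_sq_eq_dotProduct_self (v : EuclideanSpace ℝ ι) : ‖v‖ ^ 2 = v.ofLp ⬝ᵥ v.ofLp := by
  rw [EuclideanSpace.real_norm_sq_eq]
  exact Finset.sum_congr rfl fun _ _ => sq _

theorem dotProduct_mulVec_self_of_skew {A : Matrix ι ι ℝ} (hA : Aᵀ = -A) (u : ι → ℝ) :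
    u ⬝ᵥ A *ᵥ u = 0 := by
  have h : u ⬝ᵥ A *ᵥ u = u ⬝ᵥ Aᵀ *ᵥ u := by
    rw [Matrix.dotProduct_mulVec, Matrix.mulVec_transpose, dotProduct_comm]
  rw [hA, Matrix.neg_mulVec, dotProduct_neg] at h
  linarith

theorem dotProduct_sq_le (u v : ι → ℝ) : (u ⬝ᵥ v) ^ 2 ≤ (u ⬝ᵥ u) * (v ⬝ᵥ v) := by
  simpa only [dotProduct, sq] using Finset.sum_mul_sq_le_sq_mul_sq Finset.univ u v

theorem mulVec_dotProduct_self_le (A : Matrix ι ι ℝ) (u : ι → ℝ) :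
    A *ᵥ u ⬝ᵥ A *ᵥ u ≤ (∑ i, ∑ j, A i j ^ 2) * (u ⬝ᵥ u) := by
  rw [Finset.sum_mul]
  refine Finset.sum_le_sum fun i _ => ?_
  simpa only [Matrix.mulVec, dotProduct, sq] using dotProduct_sq_le (A i) u

-- The factor `2` comes from applying Cauchy–Schwarz to the pairing of the entries of `A` with the
-- antisymmetric tensor `B = v ⊗ u - u ⊗ v`, where `v = A u`.
theorem two_mul_mulVec_dotProduct_self_le_of_skew {A : Matrix ι ι ℝ} (hA : Aᵀ = -A)
    (u : ι → ℝ) : 2 * (A *ᵥ u ⬝ᵥ A *ᵥ u) ≤ (∑ i, ∑ j, A i j ^ 2) * (u ⬝ᵥ u) := by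
  set v := A *ᵥ u with hv
  have u_dot_v : u ⬝ᵥ v = 0 := dotProduct_mulVec_self_of_skew hA u
  let B (p : ι × ι) : ℝ := v p.1 * u p.2 - u p.1 * v p.2
  have hAB : (fun p : ι × ι => A p.1 p.2) ⬝ᵥ B = 2 * (v ⬝ᵥ v) := by
    have pairing (x y : ι → ℝ) : ∑ i, ∑ j, A i j * (x i * y j) = x ⬝ᵥ A *ᵥ y := by
      simp only [Matrix.mulVec, dotProduct, Finset.mul_sum, mul_left_comm]
    calc (fun p : ι × ι => A p.1 p.2) ⬝ᵥ B = v ⬝ᵥ A *ᵥ u - u ⬝ᵥ A *ᵥ v := by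
          simp only [dotProduct, Fintype.sum_prod_type, B, mul_sub, Finset.sum_sub_distrib, pairing]
      _ = v ⬝ᵥ v - Aᵀ *ᵥ u ⬝ᵥ v := by
          rw [← hv, Matrix.dotProduct_mulVec u, ← Matrix.mulVec_transpose]
      _ = 2 * (v ⬝ᵥ v) := by rw [hA, Matrix.neg_mulVec, neg_dotProduct, ← hv]; ring
  have hBB : B ⬝ᵥ B = 2 * ((u ⬝ᵥ u) * (v ⬝ᵥ v)) := by
    calc B ⬝ᵥ B = ∑ i, ∑ j, (v i * v i) * (u j * u j) + ∑ i, ∑ j, (u i * u i) * (v j * v j) -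
          2 * ∑ i, ∑ j, (u i * v i) * (u j * v j) := by
          simp only [dotProduct, Fintype.sum_prod_type, B, Finset.mul_sum,
            ← Finset.sum_add_distrib, ← Finset.sum_sub_distrib]
          exact Finset.sum_congr rfl fun i _ => Finset.sum_congr rfl fun j _ => by ring
      _ = (v ⬝ᵥ v) * (u ⬝ᵥ u) + (u ⬝ᵥ u) * (v ⬝ᵥ v) - 2 * ((u ⬝ᵥ v) * (u ⬝ᵥ v)) := by
          simp only [← Finset.sum_mul_sum, dotProduct]
      _ = 2 * ((u ⬝ᵥ u) * (v ⬝ᵥ v)) := by rw [u_dot_v]; ring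
  have cauchy := dotProduct_sq_le (fun p : ι × ι => A p.1 p.2) B
  have hAA : (fun p : ι × ι => A p.1 p.2) ⬝ᵥ (fun p => A p.1 p.2) = ∑ i, ∑ j, A i j ^ 2 := by
    simp only [dotProduct, Fintype.sum_prod_type, sq]
  rw [hAB, hBB, hAA] at cauchy
  rcases (dotProduct_self_nonneg v).eq_or_lt with hv0 | hv_pos
  · rw [← hv0, mul_zero]
    exact mul_nonneg (by positivity) (dotProduct_self_nonneg u)
  · exact le_of_mul_le_mul_right (by linarith) hv_pos

theorem two_mul_dotProduct_le (u v : ι → ℝ) : 2 * (u ⬝ᵥ v) ≤ u ⬝ᵥ u + v ⬝ᵥ v := by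
  have h := dotProduct_self_nonneg (u - v)
  rw [sub_dotProduct, dotProduct_sub, dotProduct_sub, dotProduct_comm v u] at h
  linarith

end SkewMatrices

namespace StepTwoCarnot

variable {n m : ℕ} (G : StepTwoCarnot n m)

section Contractions

variable (p : Space n m)

theorem pencil_skew : (G.pencil p)ᵀ = -G.pencil p := by
  simp only [pencil, Matrix.transpose_sum, Matrix.transpose_smul, G.skew, smul_neg,
    Finset.sum_neg_distrib]

theorem hor_dot_rot : p.1.ofLp ⬝ᵥ G.rot p = 0 :=
  dotProduct_mulVec_self_of_skew (G.pencil_skew p) _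

theorem rot_dot_rot2 : G.rot p ⬝ᵥ G.rot2 p = 0 := by
  rw [rot2, pencil_skew, Matrix.neg_mulVec, dotProduct_neg,
    dotProduct_mulVec_self_of_skew (G.pencil_skew p), neg_zero]

theorem hor_dot_rot2 : p.1.ofLp ⬝ᵥ G.rot2 p = G.rotSq p := by
  rw [rot2, Matrix.dotProduct_mulVec, Matrix.vecMul_transpose]; rfl

theorem hasHorDivAt_fst : G.HasHorDivAt (fun q => q.1.ofLp) n p :=
  ⟨1, G.hasHorJacAt_fst p, by simp⟩

theorem hasHorDivAt_rot : G.HasHorDivAt G.rot (G.twistSq p / 2) p := by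
  refine ⟨_, G.hasHorJacAt_rot p, ?_⟩
  have trace_pencil : (G.pencil p).trace = 0 := by
    rw [pencil, Matrix.trace_sum]
    exact Finset.sum_eq_zero fun k _ => by simp [Matrix.trace, G.diag_eq_zero]
  rw [Matrix.trace_add, Matrix.trace_transpose, trace_pencil, Matrix.trace_smul, Matrix.trace_sum]
  simp only [Matrix.trace_vecMulVec, twistSq, smul_eq_mul]
  ring

theorem hasHorDivAt_rot2 :
    G.HasHorDivAt G.rot2
      (G.frobSq p - (∑ k, G.twist k p ⬝ᵥ G.Λ k *ᵥ G.rot p) / 2) p := by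
  rw [funext G.rot2_eq_sum]
  refine ⟨_, HasHorJacAt.sum fun k _ =>
    ((G.hasHorJacAt_rot p).mulVec (G.Λ k)ᵀ).smul (G.hasHorGradAt_snd p k), ?_⟩
  have twist_part : Matrix.trace (∑ k, Matrix.vecMulVec (G.twist k p) (G.twist k p) *
      G.pencil p) = 0 := by
    rw [Matrix.trace_sum]
    refine Finset.sum_eq_zero fun k _ => ?_
    rw [Matrix.vecMulVec_mul, Matrix.trace_vecMulVec, dotProduct_comm,
      ← Matrix.dotProduct_mulVec, dotProduct_mulVec_self_of_skew (G.pencil_skew p)]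
  have frob_part : Matrix.trace ((G.pencil p)ᵀ * G.pencil p) = G.frobSq p := by
    rw [Matrix.trace_mul_comm]
    simp only [Matrix.trace, Matrix.diag, Matrix.mul_apply, Matrix.transpose_apply, frobSq, sq]
  have factor (J : Matrix (Fin n) (Fin n) ℝ) :
      ∑ k, p.2 k • (J * ((G.Λ k)ᵀ)ᵀ) = J * G.pencil p := by
    simp only [Matrix.transpose_transpose, pencil, Finset.mul_sum, mul_smul_comm]
  rw [Finset.sum_add_distrib, factor, add_mul, smul_mul_assoc, Finset.sum_mul, Matrix.trace_add,
    Matrix.trace_add, Matrix.trace_smul, twist_part, frob_part, smul_zero, zero_add, add_comm,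
    sub_eq_add_neg, Matrix.trace_sum, Finset.sum_div, ← Finset.sum_neg_distrib]
  refine congrArg _ (Finset.sum_congr rfl fun k _ => ?_)
  rw [Matrix.smul_vecMulVec, Matrix.trace_smul, Matrix.trace_vecMulVec, G.skew, Matrix.neg_mulVec,
    dotProduct_neg, smul_eq_mul]
  ring

end Contractions

section Bounds

variable (p : Space n m)

theorem horSq_nonneg : 0 ≤ horSq p := dotProduct_self_nonneg _

theorem rotSq_nonneg : 0 ≤ G.rotSq p := dotProduct_self_nonneg _

theorem twistSq_nonneg : 0 ≤ G.twistSq p := Finset.sum_nonneg fun _ _ => dotProduct_self_nonneg _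

theorem totalSq_nonneg : 0 ≤ G.totalSq := by
  unfold totalSq; positivity

theorem twistSq_le : G.twistSq p ≤ G.totalSq * horSq p := by
  rw [totalSq, Finset.sum_mul]
  exact Finset.sum_le_sum fun k _ => mulVec_dotProduct_self_le _ _

theorem frobSq_le : G.frobSq p ≤ G.totalSq * (p.2.ofLp ⬝ᵥ p.2.ofLp) := by
  have entry (i j : Fin n) :
      G.pencil p i j ^ 2 ≤ (∑ k, G.Λ k i j ^ 2) * (p.2.ofLp ⬝ᵥ p.2.ofLp) := by
    simpa only [pencil, Matrix.sum_apply, Matrix.smul_apply, smul_eq_mul, dotProduct, sq,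
      mul_comm (∑ k, p.2 k * p.2 k)] using dotProduct_sq_le p.2.ofLp fun k => G.Λ k i j
  calc G.frobSq p ≤ ∑ i, ∑ j, (∑ k, G.Λ k i j ^ 2) * (p.2.ofLp ⬝ᵥ p.2.ofLp) :=
        Finset.sum_le_sum fun i _ => Finset.sum_le_sum fun j _ => entry i j
    _ = G.totalSq * (p.2.ofLp ⬝ᵥ p.2.ofLp) := by
        simp only [← Finset.sum_mul, totalSq]
        rw [Finset.sum_comm (s := (Finset.univ : Finset (Fin m)))]
        simp only [Finset.sum_comm (s := (Finset.univ : Finset (Fin m)))]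

theorem rotSq_le : G.rotSq p ≤ G.frobSq p * horSq p := mulVec_dotProduct_self_le _ _

theorem two_mul_rot2_dot_self_le : 2 * (G.rot2 p ⬝ᵥ G.rot2 p) ≤ G.frobSq p * G.rotSq p := by
  have h := two_mul_mulVec_dotProduct_self_le_of_skew (G.pencil_skew p) (G.rot p)
  rwa [rot2, pencil_skew, Matrix.neg_mulVec, neg_dotProduct, dotProduct_neg, neg_neg]

theorem sum_twist_dot_mul_le :
    ∑ k, (G.twist k p ⬝ᵥ G.rot2 p) * (G.twist k p ⬝ᵥ G.rot p) ≤
      G.twistSq p * (G.rot2 p ⬝ᵥ G.rot2 p + G.rotSq p) / 2 := by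
  rw [twistSq, Finset.sum_mul, Finset.sum_div]
  refine Finset.sum_le_sum fun k _ => ?_
  have h2 := dotProduct_sq_le (G.twist k p) (G.rot2 p)
  have h1 := dotProduct_sq_le (G.twist k p) (G.rot p)
  have amgm := two_mul_le_add_sq (G.twist k p ⬝ᵥ G.rot2 p) (G.twist k p ⬝ᵥ G.rot p)
  rw [rotSq, mul_add]
  linarith

theorem sum_twist_dot_le :
    ∑ k, G.twist k p ⬝ᵥ G.Λ k *ᵥ G.rot p ≤ (G.twistSq p + G.totalSq * G.rotSq p) / 2 := by
  rw [twistSq, totalSq, Finset.sum_mul, ← Finset.sum_add_distrib, Finset.sum_div]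
  refine Finset.sum_le_sum fun k _ => ?_
  have amgm := two_mul_dotProduct_le (G.twist k p) (G.Λ k *ᵥ G.rot p)
  have frob := mulVec_dotProduct_self_le (G.Λ k) (G.rot p)
  rw [rotSq]
  linarith

open scoped Matrix.Norms.Frobenius in
theorem exists_frobSq_ge : ∃ γ > 0, ∀ p : Space n m, γ * (p.2.ofLp ⬝ᵥ p.2.ofLp) ≤ G.frobSq p := by
  let T : EuclideanSpace ℝ (Fin m) →ₗ[ℝ] Matrix (Fin n) (Fin n) ℝ :=
    (Fintype.linearCombination ℝ G.Λ).comp (WithLp.linearEquiv 2 ℝ (Fin m → ℝ)).toLinearMap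
  have ker_T : LinearMap.ker T = ⊥ := by
    exact LinearMap.ker_eq_bot.2
      (G.indep.fintypeLinearCombination_injective.comp (WithLp.linearEquiv 2 ℝ _).injective)
  obtain ⟨C, C_pos, hC⟩ := T.exists_antilipschitzWith ker_T
  refine ⟨(C ^ 2 : ℝ)⁻¹, by positivity, fun p => ?_⟩
  have norm_T : ‖T p.2‖ ^ 2 = G.frobSq p := by
    have T_eq : T p.2 = G.pencil p := rfl
    rw [T_eq, Matrix.frobenius_norm_def, ← Real.sqrt_eq_rpow, Real.sq_sqrt (by positivity), frobSq]
    simp only [Real.rpow_two, Real.norm_eq_abs, sq_abs]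
  rw [inv_mul_le_iff₀ (by positivity), ← norm_sq_eq_dotProduct_self, ← norm_T, ← mul_pow]
  gcongr
  simpa using hC.le_mul_dist p.2 0

end Bounds

section GradientContractions

variable (a : ℝ) (p : Space n m)

theorem gaugeFourGrad_dot_hor : G.gaugeFourGrad a p ⬝ᵥ p.1.ofLp = 4 * horSq p ^ 2 := by
  rw [gaugeFourGrad, add_dotProduct, smul_dotProduct, smul_dotProduct, dotProduct_comm (G.rot p),
    hor_dot_rot, smul_zero, add_zero, ← horSq, smul_eq_mul]
  ring

theorem gaugeFourGrad_dot_rot : G.gaugeFourGrad a p ⬝ᵥ G.rot p = a * G.rotSq p := by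
  rw [gaugeFourGrad, add_dotProduct, smul_dotProduct, smul_dotProduct, hor_dot_rot, smul_zero,
    zero_add, ← rotSq, smul_eq_mul]

theorem gaugeFourGrad_dot_rot2 :
    G.gaugeFourGrad a p ⬝ᵥ G.rot2 p = 4 * horSq p * G.rotSq p := by
  rw [gaugeFourGrad, add_dotProduct, smul_dotProduct, smul_dotProduct, hor_dot_rot2,
    rot_dot_rot2, smul_zero, add_zero, smul_eq_mul]

theorem rotSqGrad_dot_rot :
    G.rotSqGrad p ⬝ᵥ G.rot p = ∑ k, (G.twist k p ⬝ᵥ G.rot p) ^ 2 := by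
  simp only [rotSqGrad, add_dotProduct, smul_dotProduct, sum_dotProduct, smul_eq_mul,
    dotProduct_comm (G.rot2 p), rot_dot_rot2, mul_zero, zero_add, sq]

theorem rotSqGrad_dot_rot2 :
    G.rotSqGrad p ⬝ᵥ G.rot2 p = 2 * (G.rot2 p ⬝ᵥ G.rot2 p) +
      ∑ k, (G.twist k p ⬝ᵥ G.rot2 p) * (G.twist k p ⬝ᵥ G.rot p) := by
  simp only [rotSqGrad, add_dotProduct, smul_dotProduct, sum_dotProduct, smul_eq_mul,
    mul_comm (G.twist _ p ⬝ᵥ G.rot p)]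

end GradientContractions

section UnitBallField

variable {a : ℝ} (K c : ℝ) {p : Space n m}

/-- The denominator `|Λ(z) x|² + 1 - N⁴` of the fields on the unit gauge ball; it vanishes exactly
where the unit gauge sphere is characteristic. -/
noncomputable def den (a : ℝ) (p : Space n m) : ℝ := G.rotSq p + (1 - gaugeFour a p)

/-- The horizontal field whose divergence is very negative where `x` is small. Its first summand
does this where `1 - N⁴` is small compared with `|Λ(z) x|²`, the second one elsewhere. -/
noncomputable def poleField (a : ℝ) (p : Space n m) : Fin n → ℝ :=
  ((G.rotSq p + 4 * (1 - gaugeFour a p)) / G.den a p ^ 2) • G.rot p +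
    (-(K / G.den a p)) • G.rot2 p

/-- The field on the unit gauge ball: the Euler field `x`, corrected by the pole field where
`|x|² < c`. -/
noncomputable def ballField (a : ℝ) (p : Space n m) : Fin n → ℝ :=
  max 0 (c - horSq p) ^ 2 • G.poleField K a p + p.1.ofLp

theorem hasHorGradAt_den :
    G.HasHorGradAt (G.den a) (G.rotSqGrad p - G.gaugeFourGrad a p) p := by
  rw [sub_eq_add_neg]
  exact (G.hasHorGradAt_rotSq p).add ((G.hasHorGradAt_gaugeFour p a).const_sub 1)

theorem den_pos (hp : gaugeFour a p < 1) : 0 < G.den a p := by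
  have := G.rotSq_nonneg p
  unfold den
  linarith

theorem rotSq_div_den_le_one (hp : gaugeFour a p < 1) : G.rotSq p / G.den a p ≤ 1 :=
  (div_le_one (G.den_pos hp)).2 (le_add_of_nonneg_right (sub_nonneg.2 hp.le))

theorem hasHorDivAt_poleField (hp : gaugeFour a p < 1) :
    G.HasHorDivAt (G.poleField K a)
      ((a * G.rotSq p * (4 * (1 - gaugeFour a p) - 2 * G.rotSq p) -
          (G.rotSq p + 7 * (1 - gaugeFour a p)) * ∑ k, (G.twist k p ⬝ᵥ G.rot p) ^ 2) /
          G.den a p ^ 3 +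
        (G.rotSq p + 4 * (1 - gaugeFour a p)) / G.den a p ^ 2 * (G.twistSq p / 2) +
        (K / G.den a p ^ 2 * (2 * (G.rot2 p ⬝ᵥ G.rot2 p) +
            ∑ k, (G.twist k p ⬝ᵥ G.rot2 p) * (G.twist k p ⬝ᵥ G.rot p) -
            4 * horSq p * G.rotSq p) -
          K / G.den a p * (G.frobSq p - (∑ k, G.twist k p ⬝ᵥ G.Λ k *ᵥ G.rot p) / 2))) p := by
  have den0 : G.den a p ≠ 0 := (G.den_pos hp).ne'
  have den_sq : G.HasHorGradAt (fun q => G.den a q ^ 2) _ p :=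
    G.hasHorGradAt_den.comp (hasDerivAt_pow 2 _)
  have first := (G.hasHorDivAt_rot p).smul
    (((G.hasHorGradAt_rotSq p).add (((G.hasHorGradAt_gaugeFour p a).const_sub 1).const_mul 4)).div
      den_sq (pow_ne_zero 2 den0))
  have second := (G.hasHorDivAt_rot2 p).smul
    (G.hasHorGradAt_den.comp ((hasDerivAt_inv den0).const_mul (-K)))
  convert! first.add second using 1
  · ext1 q
    simp only [poleField, div_eq_mul_inv, neg_mul]
  · simp only [smul_dotProduct, sub_dotProduct, add_dotProduct, neg_dotProduct, smul_eq_mul,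
      gaugeFourGrad_dot_rot, gaugeFourGrad_dot_rot2, rotSqGrad_dot_rot, rotSqGrad_dot_rot2]
    field_simp
    simp only [den]
    ring

theorem horSq_le_one (ha : 0 < a) (hp : gaugeFour a p < 1) : horSq p ≤ 1 := by
  have vert := mul_nonneg ha.le (dotProduct_self_nonneg p.2.ofLp)
  unfold gaugeFour at hp
  exact (sq_le_one_iff₀ (horSq_nonneg p)).1 (by linarith)

theorem frobSq_le_div (ha : 0 < a) (hp : gaugeFour a p < 1) : G.frobSq p ≤ G.totalSq / a := by
  have vert : p.2.ofLp ⬝ᵥ p.2.ofLp ≤ 1 / a := by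
    rw [le_div_iff₀' ha]
    unfold gaugeFour at hp
    linarith [sq_nonneg (horSq p)]
  rw [div_eq_mul_one_div]
  exact (G.frobSq_le p).trans (mul_le_mul_of_nonneg_left vert G.totalSq_nonneg)

theorem rotSq_le_div_mul (ha : 0 < a) (hp : gaugeFour a p < 1) :
    G.rotSq p ≤ G.totalSq / a * horSq p :=
  (G.rotSq_le p).trans (mul_le_mul_of_nonneg_right (G.frobSq_le_div ha hp) (horSq_nonneg p))

theorem rot2_dot_self_le (ha : 0 < a) (hp : gaugeFour a p < 1) :
    G.rot2 p ⬝ᵥ G.rot2 p ≤ G.totalSq / a * G.rotSq p := by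
  have h := mul_le_mul_of_nonneg_right (G.frobSq_le_div ha hp) (G.rotSq_nonneg p)
  linarith [G.two_mul_rot2_dot_self_le p, dotProduct_self_nonneg (G.rot2 p)]

theorem sum_twist_dot_mul_le_of_lt (ha : 0 < a) (hp : gaugeFour a p < 1) :
    ∑ k, (G.twist k p ⬝ᵥ G.rot2 p) * (G.twist k p ⬝ᵥ G.rot p) ≤
      G.totalSq * (1 + G.totalSq / a) * horSq p * G.rotSq p / 2 := by
  have sum_sq_le : G.rot2 p ⬝ᵥ G.rot2 p + G.rotSq p ≤ (1 + G.totalSq / a) * G.rotSq p := by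
    linarith [G.rot2_dot_self_le ha hp]
  have h := mul_le_mul (G.twistSq_le p) sum_sq_le
    (add_nonneg (dotProduct_self_nonneg _) (G.rotSq_nonneg p))
    (mul_nonneg G.totalSq_nonneg (horSq_nonneg p))
  linarith [G.sum_twist_dot_mul_le p]

theorem sum_twist_dot_le_of_lt (ha : 0 < a) (hp : gaugeFour a p < 1) :
    ∑ k, G.twist k p ⬝ᵥ G.Λ k *ᵥ G.rot p ≤
      G.totalSq * (1 + G.totalSq / a) * horSq p / 2 := by
  have h := mul_le_mul_of_nonneg_left (G.rotSq_le_div_mul ha hp) G.totalSq_nonneg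
  linarith [G.sum_twist_dot_le p, G.twistSq_le p]

theorem frobSq_ge_of_horSq_le {γ : ℝ} (hγ : γ * (p.2.ofLp ⬝ᵥ p.2.ofLp) ≤ G.frobSq p) (hK : 0 ≤ K)
    (hKγ : K * γ = 12 * a * a) (ha : 0 < a) (hX : horSq p ≤ 1 / 2) :
    6 * a - 12 * a * (1 - gaugeFour a p) ≤ K * G.frobSq p := by
  have vert : a * (p.2.ofLp ⬝ᵥ p.2.ofLp) = gaugeFour a p - horSq p ^ 2 := by
    unfold gaugeFour
    ring
  have sq_le : horSq p ^ 2 ≤ (1 / 2) ^ 2 := pow_le_pow_left₀ (horSq_nonneg p) hX 2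
  calc 6 * a - 12 * a * (1 - gaugeFour a p) ≤ 12 * a * (gaugeFour a p - horSq p ^ 2) := by
        nlinarith
    _ = K * γ * (p.2.ofLp ⬝ᵥ p.2.ofLp) := by rw [hKγ, ← vert]; ring
    _ ≤ K * G.frobSq p := by rw [mul_assoc]; exact mul_le_mul_of_nonneg_left hγ hK

theorem rot_part_le (ha : 0 < a) (hp : gaugeFour a p < 1) :
    (a * G.rotSq p * (4 * (1 - gaugeFour a p) - 2 * G.rotSq p) -
      (G.rotSq p + 7 * (1 - gaugeFour a p)) * ∑ k, (G.twist k p ⬝ᵥ G.rot p) ^ 2) /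
      G.den a p ^ 3 ≤
    6 * a * (1 - gaugeFour a p) / G.den a p ^ 2 - a / G.den a p := by
  have den_pos := G.den_pos hp
  have rotSq_nonneg := G.rotSq_nonneg p
  have sum_nonneg : 0 ≤ ∑ k, (G.twist k p ⬝ᵥ G.rot p) ^ 2 := by positivity
  have common : 6 * a * (1 - gaugeFour a p) / G.den a p ^ 2 - a / G.den a p =
      (6 * a * (1 - gaugeFour a p) * G.den a p - a * G.den a p ^ 2) / G.den a p ^ 3 := by
    field_simp
  rw [common]
  refine div_le_div_of_nonneg_right ?_ (by positivity)
  have drop := mul_nonneg (by linarith : 0 ≤ G.rotSq p + 7 * (1 - gaugeFour a p)) sum_nonneg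
  have square := mul_nonneg ha.le
    (by positivity : 0 ≤ G.rotSq p ^ 2 + 5 * (1 - gaugeFour a p) ^ 2)
  unfold den
  linarith

theorem twist_part_le (hp : gaugeFour a p < 1) :
    (G.rotSq p + 4 * (1 - gaugeFour a p)) / G.den a p ^ 2 * (G.twistSq p / 2) ≤
      2 * (G.totalSq * horSq p) / G.den a p := by
  have den_pos := G.den_pos hp
  have twistSq_nonneg := G.twistSq_nonneg p
  have num_le : G.rotSq p + 4 * (1 - gaugeFour a p) ≤ 4 * G.den a p := by
    unfold den
    linarith [G.rotSq_nonneg p]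
  calc (G.rotSq p + 4 * (1 - gaugeFour a p)) / G.den a p ^ 2 * (G.twistSq p / 2)
      ≤ 4 * G.den a p / G.den a p ^ 2 * (G.twistSq p / 2) := by gcongr
    _ = 2 * G.twistSq p / G.den a p := by field_simp; ring
    _ ≤ 2 * (G.totalSq * horSq p) / G.den a p := by gcongr; exact G.twistSq_le p

-- `two_mul_rot2_dot_self_le` cancels `2 |Λ(z)ᵀ Λ(z) x|²` against the part `rotSq * frobSq` of
-- `den * frobSq`; the rest of the latter produces the term `-6 a (1 - N⁴) / den²`.
theorem rot2_part_le (ha : 0 < a) (hp : gaugeFour a p < 1) (hK : 0 ≤ K)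
    (hF : 6 * a - 12 * a * (1 - gaugeFour a p) ≤ K * G.frobSq p) :
    K / G.den a p ^ 2 * (2 * (G.rot2 p ⬝ᵥ G.rot2 p) +
        ∑ k, (G.twist k p ⬝ᵥ G.rot2 p) * (G.twist k p ⬝ᵥ G.rot p) - 4 * horSq p * G.rotSq p) -
      K / G.den a p * (G.frobSq p - (∑ k, G.twist k p ⬝ᵥ G.Λ k *ᵥ G.rot p) / 2) ≤
    12 * a - 6 * a * (1 - gaugeFour a p) / G.den a p ^ 2 +
      K * (G.totalSq * (1 + G.totalSq / a) * horSq p) / G.den a p := by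
  have den_pos := G.den_pos hp
  have rotSq_nonneg := G.rotSq_nonneg p
  have horSq_nonneg := horSq_nonneg p
  have rest_pos : 0 < 1 - gaugeFour a p := sub_pos.2 hp
  have M_le := G.two_mul_rot2_dot_self_le p
  have mul_le := G.sum_twist_dot_mul_le_of_lt ha hp
  have sum_le := G.sum_twist_dot_le_of_lt ha hp
  set L := G.totalSq * (1 + G.totalSq / a) * horSq p
  have hL0 : 0 ≤ L := by have := G.totalSq_nonneg; positivity
  rw [← sub_nonneg]
  have common (A B : ℝ) : 12 * a - 6 * a * (1 - gaugeFour a p) / G.den a p ^ 2 +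
      K * L / G.den a p - (K / G.den a p ^ 2 * A - K / G.den a p * B) =
      (12 * a * G.den a p ^ 2 - 6 * a * (1 - gaugeFour a p) + K * L * G.den a p - K * A +
        G.den a p * (K * B)) / G.den a p ^ 2 := by
    field_simp
    ring
  rw [common]
  refine div_nonneg ?_ (by positivity)
  have frob := mul_le_mul_of_nonneg_left hF rest_pos.le
  have den_sq := mul_le_mul_of_nonneg_left
    (pow_le_pow_left₀ rest_pos.le (le_add_of_nonneg_left rotSq_nonneg) 2) ha.le
  replace M_le := mul_le_mul_of_nonneg_left M_le hK
  replace mul_le := mul_le_mul_of_nonneg_left mul_le hK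
  replace sum_le := mul_le_mul_of_nonneg_left sum_le (mul_nonneg hK den_pos.le)
  have hor := mul_nonneg hK (mul_nonneg horSq_nonneg rotSq_nonneg)
  have spare_rot := mul_nonneg (mul_nonneg hK hL0) rotSq_nonneg
  have spare_rest := mul_nonneg (mul_nonneg hK hL0) rest_pos.le
  rw [← den] at den_sq
  rw [show G.den a p * (K * (G.frobSq p - (∑ k, G.twist k p ⬝ᵥ G.Λ k *ᵥ G.rot p) / 2)) =
    G.rotSq p * (K * G.frobSq p) + (1 - gaugeFour a p) * (K * G.frobSq p) -
      K * G.den a p * (∑ k, G.twist k p ⬝ᵥ G.Λ k *ᵥ G.rot p) / 2 by unfold den; ring]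
  have KLden : K * L * G.den a p = K * L * G.rotSq p + K * L * (1 - gaugeFour a p) := by
    unfold den; ring
  linarith

theorem exists_div_poleField_le (ha : 0 < a) (hp : gaugeFour a p < 1) (hK : 0 ≤ K)
    (hF : 6 * a - 12 * a * (1 - gaugeFour a p) ≤ K * G.frobSq p)
    (hX : G.totalSq * (1 + G.totalSq / a) * (2 + K) * horSq p ≤ a / 2) :
    ∃ d, G.HasHorDivAt (G.poleField K a) d p ∧ d ≤ 12 * a - a / 2 / G.den a p := by
  refine ⟨_, G.hasHorDivAt_poleField K hp, ?_⟩
  have den_pos := G.den_pos hp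
  have horSq_nonneg := horSq_nonneg p
  have totalSq_nonneg := G.totalSq_nonneg
  have errors : 2 * (G.totalSq * horSq p) / G.den a p +
      K * (G.totalSq * (1 + G.totalSq / a) * horSq p) / G.den a p ≤ a / 2 / G.den a p := by
    rw [← add_div]
    have extra : 0 ≤ G.totalSq * (G.totalSq / a) * horSq p := by positivity
    gcongr
    linarith
  have halves : a / G.den a p = a / 2 / G.den a p + a / 2 / G.den a p := by ring
  linarith [G.rot_part_le ha hp, G.twist_part_le hp, G.rot2_part_le K ha hp hK hF]

end UnitBallField

end StepTwoCarnot

theorem hasDerivAt_max_zero_sq (s : ℝ) :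
    HasDerivAt (fun t : ℝ => max 0 t ^ 2) (2 * max 0 s) s := by
  rcases lt_trichotomy s 0 with hs | rfl | hs
  · rw [max_eq_left hs.le, mul_zero]
    refine (hasDerivAt_const s (0 : ℝ)).congr_of_eventuallyEq ?_
    filter_upwards [Iio_mem_nhds hs] with t ht
    rw [max_eq_left ht.le, zero_pow two_ne_zero]
  · have tendsto_zero : Tendsto (fun t : ℝ => max 0 t) (𝓝[≠] 0) (𝓝 0) := by
      simpa using ((continuous_const.max continuous_id).tendsto' (0 : ℝ) 0 (max_self 0)).mono_left
        nhdsWithin_le_nhds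
    rw [max_self, mul_zero, hasDerivAt_iff_tendsto_slope]
    refine tendsto_zero.congr' ?_
    filter_upwards [self_mem_nhdsWithin] with t ht
    rcases le_total t 0 with h | h
    · simp [slope_def_field, h]
    · rw [slope_def_field, max_eq_right h, max_self, zero_pow two_ne_zero, sub_zero, sub_zero, sq,
        mul_div_cancel_right₀ _ ht]
  · rw [max_eq_right hs.le]
    refine ((hasDerivAt_pow 2 s).congr_deriv (by simp)).congr_of_eventuallyEq ?_
    filter_upwards [Ioi_mem_nhds hs] with t ht
    rw [max_eq_right ht.le]

theorem contDiff_max_zero_sq : ContDiff ℝ 1 fun t : ℝ => max 0 t ^ 2 := by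
  refine contDiff_one_iff_deriv.2 ⟨fun s => (hasDerivAt_max_zero_sq s).differentiableAt, ?_⟩
  rw [funext fun s => (hasDerivAt_max_zero_sq s).deriv]
  fun_prop

namespace StepTwoCarnot

variable {n m : ℕ} (G : StepTwoCarnot n m)

section UnitBallField

variable {a : ℝ} (K c : ℝ) {p : Space n m}

theorem poleField_dot_self_le (ha : 0 < a) (hp : gaugeFour a p < 1) :
    G.poleField K a p ⬝ᵥ G.poleField K a p ≤ (16 + K ^ 2 * (G.totalSq / a)) / G.den a p := by
  have den_pos := G.den_pos hp
  have rotSq_nonneg := G.rotSq_nonneg p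
  have : 0 < 1 - gaugeFour a p := sub_pos.2 hp
  have totalSq_nonneg := G.totalSq_nonneg
  have expand : G.poleField K a p ⬝ᵥ G.poleField K a p =
      ((G.rotSq p + 4 * (1 - gaugeFour a p)) ^ 2 * G.rotSq p / G.den a p ^ 2 +
        K ^ 2 * (G.rot2 p ⬝ᵥ G.rot2 p)) / G.den a p ^ 2 := by
    simp only [poleField, add_dotProduct, dotProduct_add, smul_dotProduct, dotProduct_smul,
      dotProduct_comm (G.rot2 p) (G.rot p), rot_dot_rot2, smul_eq_mul]
    rw [← rotSq]
    field_simp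
    ring
  have num_le : G.rotSq p + 4 * (1 - gaugeFour a p) ≤ 4 * G.den a p := by
    unfold den
    linarith
  have rotSq_le : G.rotSq p ≤ G.den a p := by
    unfold den
    linarith
  calc G.poleField K a p ⬝ᵥ G.poleField K a p
      ≤ ((4 * G.den a p) ^ 2 * G.den a p / G.den a p ^ 2 +
          K ^ 2 * (G.totalSq / a * G.den a p)) / G.den a p ^ 2 := by
        rw [expand]
        gcongr
        exact (G.rot2_dot_self_le ha hp).trans (by gcongr)
    _ = (16 + K ^ 2 * (G.totalSq / a)) / G.den a p := by field_simp; ring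

@[fun_prop]
theorem contDiff_horSq : ContDiff ℝ 1 (horSq : Space n m → ℝ) := by
  unfold horSq dotProduct
  fun_prop

@[fun_prop]
theorem contDiff_gaugeFour (a : ℝ) : ContDiff ℝ 1 (gaugeFour a : Space n m → ℝ) := by
  unfold gaugeFour dotProduct
  fun_prop

@[fun_prop]
theorem contDiff_rot : ContDiff ℝ 1 G.rot := by
  unfold rot pencil Matrix.mulVec dotProduct
  simp only [Matrix.sum_apply, Matrix.smul_apply]
  fun_prop

@[fun_prop]
theorem contDiff_rot2 : ContDiff ℝ 1 G.rot2 := by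
  have (i : Fin n) : ContDiff ℝ 1 fun q => G.rot q i := contDiff_pi.1 G.contDiff_rot i
  unfold rot2 pencil Matrix.mulVec dotProduct
  simp only [Matrix.transpose_apply, Matrix.sum_apply, Matrix.smul_apply]
  fun_prop

@[fun_prop]
theorem contDiff_rotSq : ContDiff ℝ 1 G.rotSq := by
  have (i : Fin n) : ContDiff ℝ 1 fun q => G.rot q i := contDiff_pi.1 G.contDiff_rot i
  unfold rotSq dotProduct
  fun_prop

theorem contDiffAt_ballField (hp : gaugeFour a p < 1) :
    ContDiffAt ℝ 1 (G.ballField K c a) p := by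
  have den0 : G.den a p ≠ 0 := (G.den_pos hp).ne'
  have cut : ContDiffAt ℝ 1 (fun q : Space n m => max 0 (c - horSq q) ^ 2) p :=
    (contDiff_max_zero_sq.comp (contDiff_const.sub contDiff_horSq)).contDiffAt
  unfold ballField poleField
  unfold den at den0 ⊢
  fun_prop (disch := positivity)

theorem hor_dot_poleField :
    p.1.ofLp ⬝ᵥ G.poleField K a p = -(K / G.den a p * G.rotSq p) := by
  rw [poleField, dotProduct_add, dotProduct_smul, dotProduct_smul, hor_dot_rot, hor_dot_rot2,
    smul_zero, zero_add, smul_eq_mul, neg_mul]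

theorem hasHorDivAt_ballField {d : ℝ} (h : G.HasHorDivAt (G.poleField K a) d p) :
    G.HasHorDivAt (G.ballField K c a)
      (max 0 (c - horSq p) ^ 2 * d + 4 * max 0 (c - horSq p) * (K / G.den a p * G.rotSq p) + n)
      p := by
  have cut := ((G.hasHorGradAt_horSq p).const_sub c).comp (hasDerivAt_max_zero_sq (c - horSq p))
  convert! (h.smul cut).add (G.hasHorDivAt_fst p) using 2
  rw [smul_dotProduct, neg_dotProduct, smul_dotProduct, hor_dot_poleField, smul_eq_mul, smul_eq_mul]
  ring

theorem ballField_dot_self_le (hc1 : c ≤ 1) (ha : 0 < a) (hp : gaugeFour a p < 1) :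
    G.ballField K c a p ⬝ᵥ G.ballField K c a p ≤
      2 * (max 0 (c - horSq p) ^ 2 * ((16 + K ^ 2 * (G.totalSq / a)) / G.den a p)) + 2 := by
  set ζ := max 0 (c - horSq p) ^ 2 with hζ
  have ζ_le_one : ζ ≤ 1 :=
    pow_le_one₀ (le_max_left _ _) (max_le zero_le_one (by linarith [horSq_nonneg p]))
  have pole_le := mul_le_mul_of_nonneg_left (G.poleField_dot_self_le K ha hp) (sq_nonneg _ : 0 ≤ ζ)
  have square_le := mul_le_of_le_one_left
    (mul_nonneg (sq_nonneg _ : 0 ≤ ζ) (dotProduct_self_nonneg (G.poleField K a p))) ζ_le_one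
  have cross := two_mul_dotProduct_le (ζ • G.poleField K a p) p.1.ofLp
  have expand : G.ballField K c a p ⬝ᵥ G.ballField K c a p =
      (ζ • G.poleField K a p) ⬝ᵥ (ζ • G.poleField K a p) +
        2 * ((ζ • G.poleField K a p) ⬝ᵥ p.1.ofLp) + horSq p := by
    rw [ballField, add_dotProduct, dotProduct_add, dotProduct_add, ← hζ,
      dotProduct_comm p.1.ofLp (ζ • _), ← horSq]
    ring
  have pole_sq : (ζ • G.poleField K a p) ⬝ᵥ (ζ • G.poleField K a p) =
      ζ * (ζ * (G.poleField K a p ⬝ᵥ G.poleField K a p)) := by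
    rw [smul_dotProduct, dotProduct_smul, smul_eq_mul, smul_eq_mul]
  have horSq_le_one := horSq_le_one ha hp
  rw [← horSq] at cross
  linarith

theorem exists_div_ballField_le {ε : ℝ} (ha : 0 < a) (hp : gaugeFour a p < 1) (hK : 0 ≤ K)
    (hc1 : c ≤ 1) (hε : 0 ≤ ε)
    (hεK : 2 * ε * (16 + K ^ 2 * (G.totalSq / a)) ≤ a / 2)
    (hd : ∃ d, G.HasHorDivAt (G.poleField K a) d p ∧
      (horSq p < c → d ≤ 12 * a - a / 2 / G.den a p)) :
    ∃ d, G.HasHorDivAt (G.ballField K c a) d p ∧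
      d + ε * (G.ballField K c a p ⬝ᵥ G.ballField K c a p) ≤ 12 * a + 4 * K + n + 2 * ε := by
  obtain ⟨d, hd, d_le⟩ := hd
  refine ⟨_, G.hasHorDivAt_ballField K c hd, ?_⟩
  have den_pos := G.den_pos hp
  set η := max 0 (c - horSq p) with hη
  have η_nonneg : 0 ≤ η := le_max_left _ _
  have η_le_one : η ≤ 1 := max_le zero_le_one (by linarith [horSq_nonneg p])
  have pole_le : η ^ 2 * d ≤ η ^ 2 * (12 * a - a / 2 / G.den a p) := by
    rcases lt_or_ge (horSq p) c with h | h
    · exact mul_le_mul_of_nonneg_left (d_le h) (sq_nonneg η)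
    · simp [hη, max_eq_left (sub_nonpos.2 h)]
  have cut_le : 4 * η * (K / G.den a p * G.rotSq p) ≤ 4 * K := by
    have h := mul_le_one₀ η_le_one (div_nonneg (G.rotSq_nonneg p) den_pos.le)
      (G.rotSq_div_den_le_one hp)
    calc 4 * η * (K / G.den a p * G.rotSq p) = 4 * K * (η * (G.rotSq p / G.den a p)) := by ring
      _ ≤ 4 * K := mul_le_of_le_one_right (by positivity) h
  have absorb : 2 * ε * (η ^ 2 * ((16 + K ^ 2 * (G.totalSq / a)) / G.den a p)) ≤
      η ^ 2 * (a / 2 / G.den a p) := by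
    calc 2 * ε * (η ^ 2 * ((16 + K ^ 2 * (G.totalSq / a)) / G.den a p))
        = η ^ 2 * (2 * ε * (16 + K ^ 2 * (G.totalSq / a)) / G.den a p) := by ring
      _ ≤ η ^ 2 * (a / 2 / G.den a p) := by gcongr
  have norm_le := mul_le_mul_of_nonneg_left (G.ballField_dot_self_le K c hc1 ha hp) hε
  have bulk := mul_le_of_le_one_left (by positivity : 0 ≤ 12 * a) (pow_le_one₀ η_nonneg η_le_one :
    η ^ 2 ≤ 1)
  linarith

theorem gaugeFourGrad_dot_poleField_ge (ha : 0 < a) (hp : gaugeFour a p < 1) :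
    (a - 4 * K * horSq p) * (G.rotSq p / G.den a p) ≤
      G.gaugeFourGrad a p ⬝ᵥ G.poleField K a p := by
  have den_pos := G.den_pos hp
  have : 0 < 1 - gaugeFour a p := sub_pos.2 hp
  have rotSq_nonneg := G.rotSq_nonneg p
  calc (a - 4 * K * horSq p) * (G.rotSq p / G.den a p)
      ≤ (a * (1 + 3 * ((1 - gaugeFour a p) / G.den a p)) - 4 * K * horSq p) *
        (G.rotSq p / G.den a p) := by
        gcongr
        exact le_mul_of_one_le_right ha.le (le_add_of_nonneg_right (by positivity))
    _ = G.gaugeFourGrad a p ⬝ᵥ G.poleField K a p := by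
        rw [poleField, dotProduct_add, dotProduct_smul, dotProduct_smul, gaugeFourGrad_dot_rot,
          gaugeFourGrad_dot_rot2, smul_eq_mul, smul_eq_mul]
        field_simp
        unfold den
        ring

theorem gaugeFourGrad_dot_ballField_ge (ha : 0 < a) (hp : gaugeFour a p < 1) (hK : 0 ≤ K)
    (hc : 0 ≤ c) (hKc : 4 * K * c ≤ a / 2) :
    min (a / 8) 1 * c ^ 2 * (G.rotSq p / G.den a p) ≤
      G.gaugeFourGrad a p ⬝ᵥ G.ballField K c a p := by
  have den_pos := G.den_pos hp
  have ratio_nonneg := div_nonneg (G.rotSq_nonneg p) den_pos.le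
  have : 0 ≤ horSq p := horSq_nonneg p
  have pole_ge := G.gaugeFourGrad_dot_poleField_ge K ha hp
  rw [ballField, dotProduct_add, dotProduct_smul, gaugeFourGrad_dot_hor, smul_eq_mul]
  rcases le_total (horSq p) (c / 2) with near | far
  · have cut_ge : (c / 2) ^ 2 ≤ max 0 (c - horSq p) ^ 2 := by
      gcongr
      exact le_max_of_le_right (by linarith)
    have slope_ge : a / 2 ≤ a - 4 * K * horSq p := by
      have := mul_le_mul_of_nonneg_left (show horSq p ≤ c by linarith) (by positivity : 0 ≤ 4 * K)
      linarith
    calc min (a / 8) 1 * c ^ 2 * (G.rotSq p / G.den a p)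
        ≤ a / 8 * c ^ 2 * (G.rotSq p / G.den a p) := by gcongr; exact min_le_left _ _
      _ = (c / 2) ^ 2 * (a / 2 * (G.rotSq p / G.den a p)) := by ring
      _ ≤ max 0 (c - horSq p) ^ 2 * (G.gaugeFourGrad a p ⬝ᵥ G.poleField K a p) := by
        gcongr
        exact pole_ge.trans' (by gcongr)
      _ ≤ _ := le_add_of_nonneg_right (by positivity)
  · have pole_nonneg :
        0 ≤ max 0 (c - horSq p) ^ 2 * (G.gaugeFourGrad a p ⬝ᵥ G.poleField K a p) := by
      rcases le_total c (horSq p) with h | h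
      · simp [max_eq_left (sub_nonpos.2 h)]
      · have := mul_le_mul_of_nonneg_left h (by positivity : 0 ≤ 4 * K)
        exact mul_nonneg (sq_nonneg _) (pole_ge.trans' (mul_nonneg (by linarith) ratio_nonneg))
    calc min (a / 8) 1 * c ^ 2 * (G.rotSq p / G.den a p) ≤ 1 * c ^ 2 * 1 := by
          gcongr
          exacts [min_le_right _ _, G.rotSq_div_den_le_one hp]
      _ = 4 * (c / 2) ^ 2 := by ring
      _ ≤ 4 * horSq p ^ 2 := by gcongr
      _ ≤ _ := le_add_of_nonneg_left pole_nonneg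

theorem exists_forall_div_poleField_le (ha : 0 < a) :
    ∃ K c, 0 ≤ K ∧ 0 < c ∧ c ≤ 1 ∧ 4 * K * c ≤ a / 2 ∧ ∀ p, gaugeFour a p < 1 →
      ∃ d, G.HasHorDivAt (G.poleField K a) d p ∧
        (horSq p < c → d ≤ 12 * a - a / 2 / G.den a p) := by
  obtain ⟨γ, γ_pos, hγ⟩ := G.exists_frobSq_ge
  have totalSq_nonneg := G.totalSq_nonneg
  obtain ⟨K, K_nonneg, hK⟩ : ∃ K, 0 ≤ K ∧ K * γ = 12 * a * a :=
    ⟨12 * a * a / γ, by positivity, div_mul_cancel₀ _ γ_pos.ne'⟩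
  set B := G.totalSq * (1 + G.totalSq / a) * (2 + K)
  have B_nonneg : 0 ≤ B := by positivity
  obtain ⟨c, c_pos, c_le_half, hBc⟩ : ∃ c, 0 < c ∧ c ≤ 1 / 2 ∧ (B + 4 * K) * c ≤ a / 2 := by
    refine ⟨min (1 / 2) (a / 2 / (B + 4 * K + 1)), by positivity, min_le_left _ _, ?_⟩
    calc (B + 4 * K) * min (1 / 2) (a / 2 / (B + 4 * K + 1))
        ≤ (B + 4 * K + 1) * (a / 2 / (B + 4 * K + 1)) :=
          mul_le_mul (by linarith) (min_le_right _ _) (by positivity) (by positivity)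
      _ = a / 2 := mul_div_cancel₀ _ (by positivity)
  have Bc_nonneg := mul_nonneg B_nonneg c_pos.le
  have Kc_nonneg := mul_nonneg K_nonneg c_pos.le
  refine ⟨K, c, K_nonneg, c_pos, by linarith, by linarith, fun p hp => ?_⟩
  rcases lt_or_ge (horSq p) c with hX | hX
  · obtain ⟨d, hd, d_le⟩ := G.exists_div_poleField_le K ha hp K_nonneg
      (G.frobSq_ge_of_horSq_le K (hγ p) K_nonneg hK ha (by linarith))
      (by linarith [mul_le_mul_of_nonneg_left hX.le B_nonneg])
    exact ⟨d, hd, fun _ => d_le⟩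
  · exact ⟨_, G.hasHorDivAt_poleField K hp, fun h => absurd h hX.not_gt⟩

/-- A horizontal field on the open unit gauge ball whose divergence is bounded above even after
adding a multiple of `|W|²`, while its flux through the gauge spheres `{N = ρ}` stays bounded below
as `ρ → 1`, off the characteristic points. -/
structure IsBarrier (a : ℝ) (W : Space n m → Fin n → ℝ) (ε D : ℝ) : Prop where
  contDiffAt : ∀ p, gaugeFour a p < 1 → ContDiffAt ℝ 1 W p
  div_le : ∀ p, gaugeFour a p < 1 → ∃ d, G.HasHorDivAt W d p ∧ d + ε * (W p ⬝ᵥ W p) ≤ D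
  flux_ge : ∀ p, gaugeFour a p < 1 → G.rotSq p / G.den a p ≤ G.gaugeFourGrad a p ⬝ᵥ W p

theorem exists_isBarrier (ha : 0 < a) :
    ∃ W ε D, 0 < ε ∧ 0 ≤ D ∧ G.IsBarrier a W ε D := by
  obtain ⟨K, c, K_nonneg, c_pos, c_le_one, hKc, div_pole⟩ := G.exists_forall_div_poleField_le ha
  have totalSq_nonneg := G.totalSq_nonneg
  obtain ⟨ε, ε_pos, hε⟩ : ∃ ε, 0 < ε ∧ 2 * ε * (16 + K ^ 2 * (G.totalSq / a)) ≤ a / 2 :=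
    ⟨a / 4 / (16 + K ^ 2 * (G.totalSq / a)), by positivity, le_of_eq (by field_simp; norm_num)⟩
  obtain ⟨c₁, c₁_pos, hc₁⟩ : ∃ c₁, 0 < c₁ ∧ c₁ = min (a / 8) 1 * c ^ 2 :=
    ⟨_, by positivity, rfl⟩
  refine ⟨fun p => c₁⁻¹ • G.ballField K c a p, c₁ * ε, c₁⁻¹ * (12 * a + 4 * K + n + 2 * ε),
    by positivity, by positivity,
    fun p hp => (G.contDiffAt_ballField K c hp).const_smul _, fun p hp => ?_, fun p hp => ?_⟩
  · obtain ⟨d, hd, d_le⟩ :=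
      G.exists_div_ballField_le K c ha hp K_nonneg c_le_one ε_pos.le hε (div_pole p hp)
    refine ⟨c₁⁻¹ * d, hd.const_smul c₁⁻¹, le_of_eq_of_le ?_
      (mul_le_mul_of_nonneg_left d_le (inv_nonneg.2 c₁_pos.le))⟩
    rw [smul_dotProduct, dotProduct_smul, smul_eq_mul, smul_eq_mul]
    field_simp
  · rw [dotProduct_smul, smul_eq_mul, le_inv_mul_iff₀ c₁_pos, hc₁]
    exact G.gaugeFourGrad_dot_ballField_ge K c ha hp K_nonneg c_pos.le hKc

end UnitBallField

section Gauge

variable {a : ℝ}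

theorem norm_fst_sq (p : Space n m) : ‖p.1‖ ^ 2 = horSq p :=
  norm_sq_eq_dotProduct_self p.1

theorem gauge_eq (a : ℝ) (p : Space n m) : gauge a p = gaugeFour a p ^ ((1 : ℝ) / 4) := by
  rw [gauge, gaugeFour, ← norm_fst_sq, ← norm_sq_eq_dotProduct_self, ← pow_mul]

theorem gaugeFour_nonneg (ha : 0 ≤ a) (p : Space n m) : 0 ≤ gaugeFour a p :=
  add_nonneg (sq_nonneg _) (mul_nonneg ha (dotProduct_self_nonneg _))

theorem gauge_nonneg (ha : 0 ≤ a) (p : Space n m) : 0 ≤ gauge a p := by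
  rw [gauge_eq]
  exact Real.rpow_nonneg (gaugeFour_nonneg ha p) _

theorem gauge_pow_four (ha : 0 ≤ a) (p : Space n m) : gauge a p ^ 4 = gaugeFour a p := by
  rw [gauge_eq, ← Real.rpow_natCast, ← Real.rpow_mul (gaugeFour_nonneg ha p)]
  norm_num

theorem continuous_gauge (a : ℝ) : Continuous (gauge a : Space n m → ℝ) := by
  rw [funext (gauge_eq a)]
  exact (contDiff_gaugeFour a).continuous.rpow_const fun _ => Or.inr (by norm_num)

theorem isCompact_gaugeFour_le (ha : 0 < a) (v : ℝ) :
    IsCompact {p : Space n m | gaugeFour a p ≤ v} := by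
  refine isCompact_of_isClosed_isBounded
    (isClosed_le (contDiff_gaugeFour a).continuous continuous_const) ?_
  refine (isBounded_closedBall (x := 0) (r := 1 + |v| + |v| / a)).subset fun p hp => ?_
  have le_abs : gaugeFour a p ≤ |v| := le_trans hp (le_abs_self v)
  have fst_le : ‖p.1‖ ≤ 1 + |v| := by
    have pow_le : ‖p.1‖ ^ 4 ≤ |v| := by
      rw [show ‖p.1‖ ^ 4 = (‖p.1‖ ^ 2) ^ 2 by ring, norm_fst_sq]
      exact (le_add_of_nonneg_right (mul_nonneg ha.le (dotProduct_self_nonneg _))).trans le_abs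
    nlinarith [sq_nonneg (‖p.1‖ ^ 2 - 1), sq_nonneg (‖p.1‖ - 1)]
  have snd_le : ‖p.2‖ ≤ 1 + |v| / a := by
    have sq_le : ‖p.2‖ ^ 2 ≤ |v| / a := by
      rw [le_div_iff₀' ha, norm_sq_eq_dotProduct_self]
      exact (le_add_of_nonneg_left (sq_nonneg _)).trans le_abs
    nlinarith [sq_nonneg (‖p.2‖ - 1)]
  have div_nonneg : 0 ≤ |v| / a := by positivity
  rw [mem_closedBall_zero_iff, Prod.norm_def]
  exact max_le (by linarith) (by linarith [abs_nonneg v])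

end Gauge

section Dilation

/-- The group dilation `(x, z) ↦ (r x, r² z)`. -/
noncomputable def dilate (r : ℝ) (p : Space n m) : Space n m := (r • p.1, r ^ 2 • p.2)

theorem contDiff_dilate (r : ℝ) : ContDiff ℝ 1 (dilate r : Space n m → Space n m) := by
  unfold dilate
  fun_prop

variable (r : ℝ) (p : Space n m)

theorem dilate_add_smul_field (i : Fin n) (s : ℝ) :
    dilate r (p + s • G.field i p) = dilate r p + (r * s) • G.field i (dilate r p) := by
  ext j
  · simp [dilate, field]
  · simp only [dilate, field, Prod.snd_add, Prod.smul_snd, PiLp.add_apply, PiLp.smul_apply,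
      smul_eq_mul, mul_left_comm _ r, ← Finset.mul_sum]
    ring

theorem gaugeFour_dilate (a : ℝ) : gaugeFour a (dilate r p) = r ^ 4 * gaugeFour a p := by
  simp only [gaugeFour, horSq, dilate, WithLp.ofLp_smul, smul_dotProduct, dotProduct_smul,
    smul_eq_mul]
  ring

theorem rotSq_dilate : G.rotSq (dilate r p) = r ^ 6 * G.rotSq p := by
  have rot_dilate : G.rot (dilate r p) = r ^ 3 • G.rot p := by
    have pencil_dilate : G.pencil (dilate r p) = r ^ 2 • G.pencil p := by
      simp only [pencil, dilate, PiLp.smul_apply, smul_assoc, Finset.smul_sum]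
    rw [rot, pencil_dilate, dilate, WithLp.ofLp_smul, Matrix.smul_mulVec, Matrix.mulVec_smul,
      smul_smul, rot]
    ring_nf
  rw [rotSq, rot_dilate, smul_dotProduct, dotProduct_smul, smul_smul, rotSq, smul_eq_mul]
  ring

variable {G r p}

theorem HasHorDivAt.dilate {V : Space n m → Fin n → ℝ} {d : ℝ}
    (h : G.HasHorDivAt V d (dilate r p)) :
    G.HasHorDivAt (fun q => r • V (StepTwoCarnot.dilate r q)) (r ^ 2 * d) p := by
  obtain ⟨J, hJ, rfl⟩ := h
  refine ⟨r ^ 2 • J, fun i => ?_, by rw [Matrix.trace_smul, smul_eq_mul]⟩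
  have scaled : HasDerivAt (fun s : ℝ => r * s) r 0 := by
    simpa using (hasDerivAt_id (0 : ℝ)).const_mul r
  have along : HasDerivAt
      (fun s : ℝ => V (StepTwoCarnot.dilate r p + s • G.field i (StepTwoCarnot.dilate r p)))
      (J i) (r * 0) := by
    rw [mul_zero]
    exact hJ i
  change HasDerivAt (fun s : ℝ => r • V (StepTwoCarnot.dilate r (p + s • G.field i p)))
    (r ^ 2 • J i) 0
  simp only [dilate_add_smul_field]
  rw [sq, mul_smul]
  exact (along.scomp (0 : ℝ) scaled).const_smul r

end Dilation

end StepTwoCarnot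

/-- A nonincreasing `C¹` profile that vanishes on a half-line starting before `1`; its composition
with `N⁴` truncates fields defined on the unit gauge ball. -/
structure IsCutoff (κ : ℝ → ℝ) : Prop where
  contDiff : ContDiff ℝ 1 κ
  antitone : Antitone κ
  nonneg : ∀ ρ, 0 ≤ κ ρ
  exists_eq_zero : ∃ ρ₀ < 1, ∀ ρ, ρ₀ ≤ ρ → κ ρ = 0

theorem IsCutoff.eventually_eq_zero {κ : ℝ → ℝ} (hκ : IsCutoff κ) {ρ : ℝ} (hρ : 1 ≤ ρ) :
    ∀ᶠ ρ' in 𝓝 ρ, κ ρ' = 0 := by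
  obtain ⟨ρ₀, hρ₀, eq_zero⟩ := hκ.exists_eq_zero
  filter_upwards [lt_mem_nhds (hρ₀.trans_le hρ)] with ρ' hρ' using eq_zero ρ' hρ'.le

theorem IsCutoff.deriv_eq_zero {κ : ℝ → ℝ} (hκ : IsCutoff κ) {ρ : ℝ} (hρ : 1 ≤ ρ) :
    deriv κ ρ = 0 := by
  rw [EventuallyEq.deriv_eq (f := fun _ => 0) (hκ.eventually_eq_zero hρ), deriv_const]

namespace StepTwoCarnot

variable {n m : ℕ} {G : StepTwoCarnot n m} {a ε D : ℝ} {W : Space n m → Fin n → ℝ} {κ : ℝ → ℝ}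

section Cutoff

theorem eventually_cutoff_gaugeFour_eq_zero (hκ : IsCutoff κ) {p : Space n m}
    (hp : 1 ≤ gaugeFour a p) : ∀ᶠ p' in 𝓝 p, κ (gaugeFour a p') = 0 :=
  (contDiff_gaugeFour a).continuous.continuousAt.eventually (hκ.eventually_eq_zero hp)

theorem hasCompactSupport_cutoff_gaugeFour_dilate (ha : 0 < a) (hκ : IsCutoff κ) {r : ℝ}
    (hr : 0 < r) : HasCompactSupport fun p : Space n m => κ (gaugeFour a (dilate r p)) := by
  obtain ⟨ρ₀, -, eq_zero⟩ := hκ.exists_eq_zero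
  refine HasCompactSupport.of_support_subset_isCompact (isCompact_gaugeFour_le ha (ρ₀ / r ^ 4))
    fun p hp => ?_
  rw [Set.mem_ofPred_eq, le_div_iff₀' (by positivity), ← gaugeFour_dilate]
  exact le_of_not_ge fun h => hp (eq_zero _ h)

variable (G) in
/-- The part of the divergence of a truncated barrier that is created by the cutoff, a density
carried by a collar of the unit gauge sphere. -/
noncomputable def collarDensity (a : ℝ) (κ : ℝ → ℝ) (p : Space n m) : ℝ :=
  -deriv κ (gaugeFour a p) * (G.rotSq p / G.den a p)

theorem collarDensity_nonneg (hκ : IsCutoff κ) (p : Space n m) :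
    0 ≤ G.collarDensity a κ p := by
  unfold collarDensity
  rcases lt_or_ge (gaugeFour a p) 1 with inside | outside
  · exact mul_nonneg (neg_nonneg.2 hκ.antitone.deriv_nonpos)
      (div_nonneg (G.rotSq_nonneg p) (G.den_pos inside).le)
  · rw [hκ.deriv_eq_zero outside, neg_zero, zero_mul]

namespace IsBarrier

theorem contDiff_cutoff (hW : G.IsBarrier a W ε D) (hκ : IsCutoff κ) :
    ContDiff ℝ 1 fun p => κ (gaugeFour a p) • W p := by
  rw [contDiff_iff_contDiffAt]
  intro p
  rcases lt_or_ge (gaugeFour a p) 1 with inside | outside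
  · exact (hκ.contDiff.comp (contDiff_gaugeFour a)).contDiffAt.smul (hW.contDiffAt p inside)
  · refine (contDiffAt_const (c := 0)).congr_of_eventuallyEq ?_
    filter_upwards [eventually_cutoff_gaugeFour_eq_zero hκ outside] with p' hp'
    rw [hp', zero_smul]

theorem exists_div_cutoff_le (hW : G.IsBarrier a W ε D) (hκ : IsCutoff κ) (p : Space n m) :
    ∃ d, G.HasHorDivAt (fun p => κ (gaugeFour a p) • W p) d p ∧
      G.collarDensity a κ p + d +
        ε * (κ (gaugeFour a p) * (W p ⬝ᵥ W p)) ≤ D * κ (gaugeFour a p) := by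
  unfold collarDensity
  rcases lt_or_ge (gaugeFour a p) 1 with inside | outside
  · obtain ⟨d, hd, d_le⟩ := hW.div_le p inside
    have grad_κ := (G.hasHorGradAt_gaugeFour p a).comp
      (hκ.contDiff.differentiable one_ne_zero).differentiableAt.hasDerivAt
    refine ⟨_, hd.smul grad_κ, ?_⟩
    rw [smul_dotProduct, smul_eq_mul]
    have flux := mul_le_mul_of_nonneg_left (hW.flux_ge p inside)
      (neg_nonneg.2 (hκ.antitone.deriv_nonpos (x := gaugeFour a p)))
    have bulk := mul_le_mul_of_nonneg_left d_le (hκ.nonneg (gaugeFour a p))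
    linarith
  · have eventually_zero := eventually_cutoff_gaugeFour_eq_zero hκ outside
    refine ⟨0, ⟨0, fun i => ?_, Matrix.trace_zero ..⟩, ?_⟩
    · exact ((hasFDerivAt_const (𝕜 := ℝ) (0 : Fin n → ℝ) p).hasLineDerivAt
        (G.field i p)).congr_of_eventuallyEq (eventually_zero.mono fun p' hp' => by
          simp only [hp', zero_smul])
    · rw [hκ.deriv_eq_zero outside, eventually_zero.self_of_nhds]
      simp

theorem contDiff_dilate_cutoff (hW : G.IsBarrier a W ε D) (hκ : IsCutoff κ) (r : ℝ) :
    ContDiff ℝ 1 fun p => κ (gaugeFour a (dilate r p)) • r • W (dilate r p) := by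
  simp only [smul_comm _ r]
  exact ((hW.contDiff_cutoff hκ).comp (contDiff_dilate r)).const_smul r

theorem exists_div_dilate_cutoff_le (hW : G.IsBarrier a W ε D) (hD : 0 ≤ D) (hκ : IsCutoff κ)
    {r : ℝ} (hr : 0 ≤ r) (hr1 : r ≤ 1) (p : Space n m) :
    ∃ d, G.HasHorDivAt (fun p => κ (gaugeFour a (dilate r p)) • r • W (dilate r p)) d p ∧
      r ^ 2 * G.collarDensity a κ (dilate r p) + d +
        ε * (κ (gaugeFour a (dilate r p)) * ((r • W (dilate r p)) ⬝ᵥ (r • W (dilate r p)))) ≤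
      D * κ (gaugeFour a (dilate r p)) := by
  obtain ⟨d, hd, d_le⟩ := hW.exists_div_cutoff_le hκ (dilate r p)
  simp only [smul_comm _ r]
  refine ⟨r ^ 2 * d, hd.dilate, ?_⟩
  rw [smul_dotProduct, dotProduct_smul, smul_eq_mul, smul_eq_mul]
  calc _ ≤ r ^ 2 * (D * κ (gaugeFour a (dilate r p))) := by
        linarith [mul_le_mul_of_nonneg_left d_le (sq_nonneg r)]
    _ ≤ D * κ (gaugeFour a (dilate r p)) :=
        mul_le_of_le_one_left (mul_nonneg hD (hκ.nonneg _)) (pow_le_one₀ hr hr1)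

end IsBarrier

end Cutoff

end StepTwoCarnot

section Integration

theorem lintegral_ofReal_eq_lintegral_ofReal_neg {α : Type*} [MeasurableSpace α] {μ : Measure α}
    {h : α → ℝ} (hh : Integrable h μ) (h0 : ∫ x, h x ∂μ = 0) :
    ∫⁻ x, ENNReal.ofReal (h x) ∂μ = ∫⁻ x, ENNReal.ofReal (-h x) ∂μ := by
  rw [integral_eq_lintegral_pos_part_sub_lintegral_neg_part hh, sub_eq_zero] at h0
  exact (ENNReal.toReal_eq_toReal_iff' hh.lintegral_lt_top.ne hh.neg.lintegral_lt_top.ne).1 h0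

theorem lintegral_ofReal_le_of_add_le {α : Type*} [MeasurableSpace α] {μ : Measure α}
    {b h r : α → ℝ} (hh : Integrable h μ) (h0 : ∫ x, h x ∂μ = 0) (b_nonneg : ∀ x, 0 ≤ b x)
    (le : ∀ᵐ x ∂μ, b x + h x ≤ r x) :
    ∫⁻ x, ENNReal.ofReal (b x) ∂μ ≤ ∫⁻ x, ENNReal.ofReal (r x) ∂μ := by
  have pointwise : ∀ᵐ x ∂μ, ENNReal.ofReal (b x) + ENNReal.ofReal (h x) ≤
      ENNReal.ofReal (r x) + ENNReal.ofReal (-h x) := by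
    filter_upwards [le] with x hx
    rcases le_total 0 (h x) with pos | neg
    · rw [← ENNReal.ofReal_add (b_nonneg x) pos]
      exact (ENNReal.ofReal_le_ofReal hx).trans le_self_add
    · rw [ENNReal.ofReal_of_nonpos neg, add_zero]
      exact (ENNReal.ofReal_le_ofReal (by linarith)).trans ENNReal.ofReal_add_le
  have neg_measurable : AEMeasurable (fun x => ENNReal.ofReal (-h x)) μ :=
    hh.aemeasurable.neg.ennreal_ofReal
  have integrated := lintegral_mono_ae pointwise
  rw [lintegral_add_right' _ hh.aemeasurable.ennreal_ofReal,
    lintegral_add_right' _ neg_measurable,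
    lintegral_ofReal_eq_lintegral_ofReal_neg hh h0] at integrated
  exact (ENNReal.add_le_add_iff_right hh.neg.lintegral_lt_top.ne).1 integrated

end Integration

section Young

variable {q : ℝ}

theorem locallyLipschitz_abs_rpow (hq : 1 < q) : LocallyLipschitz fun x : ℝ => |x| ^ q := by
  simpa only [Real.norm_eq_abs] using (contDiff_norm_rpow (E := ℝ) hq).locallyLipschitz

theorem abs_rpow_sub_two_mul_sq (hq : 2 ≤ q) (x : ℝ) : |x| ^ (q - 2) * x ^ 2 = |x| ^ q := by
  rw [← sq_abs, ← Real.rpow_natCast, ← Real.rpow_add_of_nonneg (abs_nonneg x) (by linarith)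
    (Nat.cast_nonneg 2)]
  norm_num

theorem rpow_sub_two_mul_sq_le (hq : 2 ≤ q) {x y : ℝ} (hx : 0 ≤ x) (hy : 0 ≤ y) :
    x ^ (q - 2) * y ^ 2 ≤ y ^ q + x ^ q := by
  have le_rpow : ∀ z, 0 ≤ z → x ≤ z → y ≤ z → x ^ (q - 2) * y ^ 2 ≤ z ^ q :=
    fun z hz hxz hyz => by
      calc x ^ (q - 2) * y ^ 2 ≤ |z| ^ (q - 2) * z ^ 2 := by
            rw [abs_of_nonneg hz]
            gcongr
        _ = z ^ q := by rw [abs_rpow_sub_two_mul_sq hq, abs_of_nonneg hz]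
  rcases le_total x y with h | h
  · exact (le_rpow y hy h le_rfl).trans (le_add_of_nonneg_right (Real.rpow_nonneg hx q))
  · exact (le_rpow x hx le_rfl h).trans (le_add_of_nonneg_left (Real.rpow_nonneg hy q))

theorem mul_dotProduct_le_rpow {ι : Type*} [Fintype ι] (hq : 2 ≤ q) {ε : ℝ} (hε : 0 < ε) (x : ℝ)
    (v : EuclideanSpace ℝ ι) (w : ι → ℝ) :
    q * |x| ^ (q - 2) * x * (v.ofLp ⬝ᵥ w) ≤
      ε * |x| ^ q * (w ⬝ᵥ w) + q ^ 2 / (4 * ε) * (‖v‖ ^ q + |x| ^ q) := by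
  have young : q * x * (v.ofLp ⬝ᵥ w) ≤ ε * x ^ 2 * (w ⬝ᵥ w) + q ^ 2 / (4 * ε) * ‖v‖ ^ 2 := by
    have h := two_mul_dotProduct_le ((q / 2) • v.ofLp) ((ε * x) • w)
    simp only [smul_dotProduct, dotProduct_smul, smul_eq_mul] at h
    rw [norm_sq_eq_dotProduct_self]
    refine le_of_mul_le_mul_left ?_ hε
    calc ε * (q * x * (v.ofLp ⬝ᵥ w)) ≤ _ := le_of_eq_of_le (by ring) h
      _ = ε * (ε * x ^ 2 * (w ⬝ᵥ w) + q ^ 2 / (4 * ε) * (v.ofLp ⬝ᵥ v.ofLp)) := by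
        field_simp
        ring
  calc q * |x| ^ (q - 2) * x * (v.ofLp ⬝ᵥ w)
      = |x| ^ (q - 2) * (q * x * (v.ofLp ⬝ᵥ w)) := by ring
    _ ≤ |x| ^ (q - 2) * (ε * x ^ 2 * (w ⬝ᵥ w) + q ^ 2 / (4 * ε) * ‖v‖ ^ 2) := by gcongr
    _ = ε * (|x| ^ (q - 2) * x ^ 2) * (w ⬝ᵥ w) +
        q ^ 2 / (4 * ε) * (|x| ^ (q - 2) * ‖v‖ ^ 2) := by ring
    _ ≤ _ := by
        rw [abs_rpow_sub_two_mul_sq hq]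
        gcongr
        exact rpow_sub_two_mul_sq_le hq (abs_nonneg x) (norm_nonneg v)

end Young

namespace StepTwoCarnot

variable {n m : ℕ} {G : StepTwoCarnot n m} {a : ℝ}

section LocLipschitz

variable {f : Space n m → ℝ}

variable (G) in
theorem sum_mul_eq_zero (j : Fin m) (p : Space n m) :
    ∑ i, (∑ l, G.Λ j i l * p.1 l) * p.1 i = 0 := by
  rw [← dotProduct_mulVec_self_of_skew (G.skew j) p.1.ofLp, dotProduct_comm]
  rfl

variable (G) in
theorem op_neg_self (p : Space n m) : G.op (-p) p = 0 := by
  ext j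
  · simp [op]
  · simp [op, G.sum_mul_eq_zero]

variable (G) in
theorem gauge_op_neg_add_smul_field (i : Fin n) (p : Space n m) (s : ℝ) :
    gauge a (G.op (-p) (p + s • G.field i p)) = |s| := by
  have translate : G.op (-p) (p + s • G.field i p) = (EuclideanSpace.single i s, 0) := by
    rw [← G.op_single]
    ext j
    · simp [op]
    · simp [op, mul_add, Finset.sum_add_distrib, G.sum_mul_eq_zero]
  rw [translate, gauge, norm_zero, PiLp.norm_single, Real.norm_eq_abs, zero_pow two_ne_zero,
    mul_zero, add_zero, ← Real.rpow_natCast, ← Real.rpow_mul (abs_nonneg s)]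
  norm_num

namespace LocLipschitz

theorem continuous (hf : G.LocLipschitz a f) : Continuous f := by
  rw [continuous_iff_continuousAt]
  intro p
  obtain ⟨K, U, hU, hK⟩ := hf p
  have continuous_dist : Continuous fun v => gauge a (G.op (-p) v) := by
    refine (continuous_gauge a).comp ?_
    unfold op
    fun_prop
  have bound_tendsto : Tendsto (fun v => K * gauge a (G.op (-p) v)) (𝓝 p) (𝓝 0) := by
    convert (continuous_dist.tendsto p).const_mul K using 2
    simp [op_neg_self, gauge]
  rw [ContinuousAt, tendsto_iff_dist_tendsto_zero]
  refine squeeze_zero' (Eventually.of_forall fun _ => dist_nonneg) ?_ bound_tendsto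
  filter_upwards [hU] with v hv
  rw [dist_comm, Real.dist_eq]
  exact hK p (mem_of_mem_nhds hU) v hv

theorem locLipAlong (hf : G.LocLipschitz a f) (i : Fin n) : LocLipAlong (G.field i) f := by
  intro p
  obtain ⟨K, U, hU, hK⟩ := hf p
  refine ⟨K, U, hU, fun q hq s hs => ?_⟩
  simpa only [gauge_op_neg_add_smul_field, abs_sub_comm] using hK q hq _ hs

theorem ae_hasHorGradAt (hf : G.LocLipschitz a f) :
    ∀ᵐ p, G.HasHorGradAt f (G.subgradient f p).ofLp p := by
  filter_upwards [ae_all_iff.2 fun i => G.ae_lineDifferentiableAt_field (hf.locLipAlong i)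
    hf.continuous] with p hp i
  exact (hp i).hasLineDerivAt

end LocLipschitz

end LocLipschitz

section Multiplier

variable {f χ b : Space n m → ℝ} {V W : Space n m → Fin n → ℝ} {d q ε D : ℝ}

theorem HasHorDivAt.sum_lineDeriv_eq {p : Space n m} (hV : G.HasHorDivAt V d p) :
    ∑ i, lineDeriv ℝ (fun q => V q i) p (G.field i p) = d := by
  obtain ⟨J, hJ, rfl⟩ := hV
  exact Finset.sum_congr rfl fun i _ => HasLineDerivAt.lineDeriv (hasDerivAt_pi.1 (hJ i) i)

theorem integral_sum_lineDeriv_eq_zero (lip : ∀ i, LocLipAlong (G.field i) fun p => V p i)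
    (cV : Continuous V) (sV : HasCompactSupport V) :
    Integrable (fun p => ∑ i, lineDeriv ℝ (fun q => V q i) p (G.field i p)) ∧
      ∫ p, ∑ i, lineDeriv ℝ (fun q => V q i) p (G.field i p) = 0 := by
  have component i := G.integral_lineDeriv_field (lip i) ((continuous_apply i).comp cV)
    (sV.comp_left (g := fun v : Fin n → ℝ => v i) rfl)
  refine ⟨integrable_finsetSum _ fun i _ => (component i).1, ?_⟩
  rw [integral_finsetSum _ fun i _ => (component i).1]
  exact Finset.sum_eq_zero fun i _ => (component i).2

theorem integral_sum_lineDeriv_abs_rpow_smul_eq_zero (hf : G.LocLipschitz a f) (hq : 1 < q)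
    (hV : ContDiff ℝ 1 V) (sV : HasCompactSupport V) :
    Integrable (fun p => ∑ i, lineDeriv ℝ (fun p' => (|f p'| ^ q • V p') i) p (G.field i p)) ∧
      ∫ p, ∑ i, lineDeriv ℝ (fun p' => (|f p'| ^ q • V p') i) p (G.field i p) = 0 := by
  have lip_power := locallyLipschitz_abs_rpow hq
  have continuous_power : Continuous fun p => |f p| ^ q := lip_power.continuous.comp hf.continuous
  refine integral_sum_lineDeriv_eq_zero (fun i => ?_) (continuous_power.smul hV.continuous)
    (sV.smul_left (f := fun p => |f p| ^ q))
  exact ((hf.locLipAlong i).comp hf.continuous lip_power).mul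
    (.of_locallyLipschitz (contDiff_pi.1 hV i).locallyLipschitz
      (G.contDiff_field (r := 0) i).continuous)
    continuous_power (contDiff_pi.1 hV i).continuous

theorem lintegral_multiplier_le (hf : G.LocLipschitz a f) (hq : 2 ≤ q) (hε : 0 < ε)
    (hV : ContDiff ℝ 1 fun p => χ p • W p) (sχ : HasCompactSupport χ) (χ_nonneg : ∀ p, 0 ≤ χ p)
    (b_nonneg : ∀ p, 0 ≤ b p)
    (div_le : ∀ p, ∃ d, G.HasHorDivAt (fun p => χ p • W p) d p ∧
      b p + d + ε * (χ p * (W p ⬝ᵥ W p)) ≤ D * χ p) :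
    ∫⁻ p, ENNReal.ofReal (b p * |f p| ^ q) ≤
      ∫⁻ p, ENNReal.ofReal (χ p *
        (q ^ 2 / (4 * ε) * ‖G.subgradient f p‖ ^ q + (q ^ 2 / (4 * ε) + D) * |f p| ^ q)) := by
  obtain ⟨integrable, integral_eq⟩ := integral_sum_lineDeriv_abs_rpow_smul_eq_zero hf
    (one_lt_two.trans_le hq) hV sχ.smul_right
  refine lintegral_ofReal_le_of_add_le integrable integral_eq
    (fun p => mul_nonneg (b_nonneg p) (by positivity)) ?_
  filter_upwards [hf.ae_hasHorGradAt] with p grad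
  obtain ⟨d, hd, d_le⟩ := div_le p
  have grad_power := grad.comp (hasDerivAt_abs_rpow (f p) (one_lt_two.trans_le hq))
  rw [(hd.smul grad_power).sum_lineDeriv_eq, smul_dotProduct, dotProduct_smul, smul_eq_mul,
    smul_eq_mul]
  have young := mul_le_mul_of_nonneg_left
    (mul_dotProduct_le_rpow hq hε (f p) (G.subgradient f p) (W p)) (χ_nonneg p)
  have weighted := mul_le_mul_of_nonneg_left d_le (by positivity : 0 ≤ |f p| ^ q)
  linarith

end Multiplier

end StepTwoCarnot

section Gibbs

variable {g : ℝ → ℝ}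

theorem deriv_nonneg_of_monotoneOn_Ici (hg : MonotoneOn g (Set.Ici 0)) {t : ℝ} (ht : 0 < t) :
    0 ≤ deriv g t := by
  rw [← derivWithin_of_mem_nhds (Ici_mem_nhds ht)]
  exact hg.derivWithin_nonneg

theorem exists_tendsto_exp_neg_atTop (hg : MonotoneOn g (Set.Ici 0)) :
    ∃ l, 0 ≤ l ∧ Tendsto (fun t => Real.exp (-g t)) atTop (𝓝 l) := by
  have anti : Antitone fun t => Real.exp (-g (max t 0)) := fun s t hst =>
    Real.exp_le_exp.2 <| neg_le_neg <|
      hg (le_max_right s 0) (le_max_right t 0) (max_le_max_right 0 hst)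
  have nonneg t : 0 ≤ Real.exp (-g (max t 0)) := (Real.exp_pos _).le
  refine ⟨⨅ t, Real.exp (-g (max t 0)), le_ciInf nonneg, ?_⟩
  refine (tendsto_atTop_ciInf anti ⟨0, Set.forall_mem_range.2 nonneg⟩).congr' ?_
  filter_upwards [eventually_ge_atTop 0] with t ht
  rw [max_eq_left ht]

theorem lintegral_Ioi_deriv_mul_exp_neg_le (hg_mono : MonotoneOn g (Set.Ici 0))
    (hg_diff : DifferentiableOn ℝ g (Set.Ici 0)) {α : ℝ} (hα : 0 < α) :
    ∫⁻ t in Set.Ioi α, ENNReal.ofReal (deriv g t * Real.exp (-g t)) ≤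
      ENNReal.ofReal (Real.exp (-g α)) := by
  obtain ⟨l, l_nonneg, hl⟩ := exists_tendsto_exp_neg_atTop hg_mono
  have hasDerivAt t (ht : α ≤ t) :
      HasDerivAt (fun t => -Real.exp (-g t)) (deriv g t * Real.exp (-g t)) t := by
    have := (hg_diff.differentiableAt (Ici_mem_nhds (hα.trans_le ht))).hasDerivAt
    simpa [mul_comm] using this.fun_neg.exp.fun_neg
  have nonneg t (ht : t ∈ Set.Ioi α) : 0 ≤ deriv g t * Real.exp (-g t) :=
    mul_nonneg (deriv_nonneg_of_monotoneOn_Ici hg_mono (hα.trans ht)) (Real.exp_pos _).le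
  have cont : ContinuousWithinAt (fun t => -Real.exp (-g t)) (Set.Ici α) α :=
    (hasDerivAt α le_rfl).continuousAt.continuousWithinAt
  rw [← ofReal_integral_eq_lintegral_ofReal
    (integrableOn_Ioi_deriv_of_nonneg cont (fun t ht => hasDerivAt t ht.le) nonneg hl.neg)
    ((ae_restrict_mem measurableSet_Ioi).mono nonneg),
    integral_Ioi_of_hasDerivAt_of_nonneg cont (fun t ht => hasDerivAt t ht.le) nonneg hl.neg]
  exact ENNReal.ofReal_le_ofReal (by linarith)

end Gibbs

section Peak

theorem ofReal_le_liminf_lintegral_Ioi {K K' : ℕ → ℝ → ℝ} {h : ℝ → ℝ} {α : ℝ}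
    (hK : ∀ k, ∀ t, α ≤ t → HasDerivAt (K k) (K' k t) t)
    (K'_cont : ∀ k, ContinuousOn (K' k) (Set.Ici α)) (K'_nonneg : ∀ k, ∀ t, α ≤ t → 0 ≤ K' k t)
    (K_left : ∀ k, K k α = 0) (K_right : ∀ β, α < β → ∀ᶠ k in atTop, K k β = 1)
    (hh : ContinuousWithinAt h (Set.Ici α) α) :
    ENNReal.ofReal (h α) ≤
      liminf (fun k => ∫⁻ t in Set.Ioi α, ENNReal.ofReal (K' k t * h t)) atTop := by
  refine le_of_forall_lt_imp_le_of_dense fun c hc => ?_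
  have c_lt : c.toReal < h α := (ENNReal.lt_ofReal_iff_toReal_lt hc.ne_top).1 hc
  obtain ⟨β, hβ, c_le⟩ : ∃ β, α < β ∧ ∀ t ∈ Set.Icc α β, c.toReal ≤ h t := by
    obtain ⟨β, hβ, h'⟩ := (mem_nhdsGE_iff_exists_Icc_subset).1 (hh.eventually_const_le c_lt)
    exact ⟨β, hβ, fun t ht => h' ht⟩
  refine le_liminf_of_le (by isBoundedDefault) ?_
  filter_upwards [K_right β hβ] with k hk
  have mass : ∫⁻ t in Set.Ioc α β, ENNReal.ofReal (K' k t) = 1 := by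
    have integrable : IntervalIntegrable (K' k) volume α β :=
      ((K'_cont k).mono fun t ht => (Set.uIcc_of_le hβ.le ▸ ht).1).intervalIntegrable
    rw [← ofReal_integral_eq_lintegral_ofReal integrable.1
      ((ae_restrict_mem measurableSet_Ioc).mono fun t ht => K'_nonneg k t ht.1.le),
      ← intervalIntegral.integral_of_le hβ.le, intervalIntegral.integral_eq_sub_of_hasDerivAt
        (fun t ht => hK k t (Set.uIcc_of_le hβ.le ▸ ht).1) integrable, hk, K_left]
    simp
  calc c = ∫⁻ t in Set.Ioc α β, ENNReal.ofReal (K' k t) * c := by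
        rw [lintegral_mul_const' _ _ hc.ne_top, mass, one_mul]
    _ ≤ ∫⁻ t in Set.Ioc α β, ENNReal.ofReal (K' k t * h t) := by
        refine setLIntegral_mono' measurableSet_Ioc fun t ht => ?_
        rw [ENNReal.ofReal_mul (K'_nonneg k t ht.1.le)]
        gcongr
        have c_le_h := c_le t ⟨ht.1.le, ht.2⟩
        exact (ENNReal.le_ofReal_iff_toReal_le hc.ne_top
          (ENNReal.toReal_nonneg.trans c_le_h)).2 c_le_h
    _ ≤ _ := lintegral_mono_set Set.Ioc_subset_Ioi_self

end Peak

section Tonelli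

variable {α β : Type*} [MeasurableSpace α] [MeasurableSpace β] {μ : Measure α} {ν : Measure β}
  [SFinite μ] [SFinite ν]

theorem lintegral_lintegral_mul_mono {w : β → ENNReal} {u v : β → α → ENNReal}
    (hw : AEMeasurable w ν) (hu : Measurable u.uncurry) (hv : Measurable v.uncurry)
    (le : ∀ᵐ t ∂ν, ∫⁻ x, u t x ∂μ ≤ ∫⁻ x, v t x ∂μ) :
    ∫⁻ x, ∫⁻ t, w t * u t x ∂ν ∂μ ≤ ∫⁻ x, ∫⁻ t, w t * v t x ∂ν ∂μ := by
  have swap {u : β → α → ENNReal} (hu : Measurable u.uncurry) :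
      ∫⁻ x, ∫⁻ t, w t * u t x ∂ν ∂μ = ∫⁻ t, w t * ∫⁻ x, u t x ∂μ ∂ν := by
    rw [← lintegral_lintegral_swap (hw.comp_fst.mul hu.aemeasurable)]
    exact lintegral_congr fun t => lintegral_const_mul _ (hu.comp measurable_prodMk_left)
  rw [swap hu, swap hv]
  refine lintegral_mono_ae (le.mono fun t ht => ?_)
  gcongr

end Tonelli

section Cutoff

/-- Cutoffs that increase to the indicator of `(-∞, 1)` as `k → ∞`. -/
noncomputable def cutoff (k : ℕ) (ρ : ℝ) : ℝ := Real.smoothTransition (k * (1 - ρ) - 1)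

variable (k : ℕ)

theorem isCutoff_cutoff : IsCutoff (cutoff k) where
  contDiff := Real.smoothTransition.contDiff.comp (by fun_prop)
  antitone ρ ρ' h := Real.smoothTransition.monotone (by gcongr)
  nonneg ρ := Real.smoothTransition.nonneg _
  exists_eq_zero := by
    refine ⟨1 - 1 / (k + 1), sub_lt_self 1 (by positivity), fun ρ hρ => ?_⟩
    refine Real.smoothTransition.zero_of_nonpos (sub_nonpos.2 ?_)
    calc k * (1 - ρ) ≤ k * (1 / (k + 1)) := by gcongr; linarith
      _ ≤ 1 := by rw [mul_one_div, div_le_one (by positivity)]; linarith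

theorem cutoff_le_one (ρ : ℝ) : cutoff k ρ ≤ 1 := Real.smoothTransition.le_one _

theorem eventually_cutoff_eq_one {ρ : ℝ} (hρ : ρ < 1) : ∀ᶠ k in atTop, cutoff k ρ = 1 := by
  have tendsto : Tendsto (fun k : ℕ => (k : ℝ) * (1 - ρ)) atTop atTop :=
    tendsto_natCast_atTop_atTop.atTop_mul_const (sub_pos.2 hρ)
  filter_upwards [tendsto.eventually_ge_atTop 2] with k hk
  exact Real.smoothTransition.one_of_one_le (by linarith)

end Cutoff

namespace StepTwoCarnot

variable {n m : ℕ} (G : StepTwoCarnot n m) {a : ℝ}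

section Collar

theorem measurable_collarDensity {κ : ℝ → ℝ} (hκ : IsCutoff κ) :
    Measurable (G.collarDensity a κ) := by
  have deriv_cont : Continuous (deriv κ) := hκ.contDiff.continuous_deriv le_rfl
  have gaugeFour_cont := (contDiff_gaugeFour (n := n) (m := m) a).continuous
  have rotSq_cont := G.contDiff_rotSq.continuous
  unfold collarDensity den
  exact (deriv_cont.comp gaugeFour_cont).measurable.neg.mul
    (rotSq_cont.measurable.div (by fun_prop))

theorem measurable_dilate_inv :
    Measurable fun x : ℝ × Space n m => dilate x.1⁻¹ x.2 := by
  unfold dilate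
  fun_prop

theorem hasDerivAt_cutoff_gaugeFour_dilate_inv {κ : ℝ → ℝ} (hκ : IsCutoff κ) (p : Space n m) {t : ℝ}
    (ht : 0 < t) :
    HasDerivAt (fun t => κ (gaugeFour a (dilate t⁻¹ p)))
      (-deriv κ (gaugeFour a (dilate t⁻¹ p)) * (4 * gaugeFour a p / t ^ 5)) t := by
  simp only [gaugeFour_dilate]
  have inner : HasDerivAt (fun t => t⁻¹ ^ 4 * gaugeFour a p) (-(4 * gaugeFour a p / t ^ 5)) t :=
    (((hasDerivAt_inv ht.ne').fun_pow 4).mul_const (gaugeFour a p)).congr_deriv (by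
      push_cast
      field_simp)
  exact ((hκ.contDiff.differentiable one_ne_zero).differentiableAt.hasDerivAt.comp t
    inner).congr_deriv (by ring)

section UnitSphere

variable {p : Space n m}

theorem gaugeFour_dilate_inv (ha : 0 ≤ a) (p : Space n m) (t : ℝ) :
    gaugeFour a (dilate t⁻¹ p) = (gauge a p / t) ^ 4 := by
  rw [gaugeFour_dilate, ← gauge_pow_four ha, div_pow, inv_pow, inv_mul_eq_div]

theorem gaugeFour_dilate_inv_gauge (ha : 0 ≤ a) (hN : gauge a p ≠ 0) :
    gaugeFour a (dilate (gauge a p)⁻¹ p) = 1 := by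
  rw [gaugeFour_dilate_inv ha, div_self hN, one_pow]

variable {G}

theorem den_dilate_inv_gauge (ha : 0 ≤ a) (hN : gauge a p ≠ 0) :
    G.den a (dilate (gauge a p)⁻¹ p) = G.rotSq (dilate (gauge a p)⁻¹ p) := by
  rw [den, gaugeFour_dilate_inv_gauge ha hN, sub_self, add_zero]

theorem rotSq_dilate_inv_gauge_ne_zero (hN : gauge a p ≠ 0) (hS : G.rotSq p ≠ 0) :
    G.rotSq (dilate (gauge a p)⁻¹ p) ≠ 0 := by
  rw [rotSq_dilate]
  positivity

theorem continuousAt_rotSq_div_den_dilate_inv (ha : 0 ≤ a) (hN : gauge a p ≠ 0)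
    (hS : G.rotSq p ≠ 0) :
    ContinuousAt (fun t => G.rotSq (dilate t⁻¹ p) / G.den a (dilate t⁻¹ p)) (gauge a p) := by
  have : ContinuousAt (fun t : ℝ => t⁻¹) (gauge a p) := continuousAt_inv₀ hN
  refine ContinuousAt.div ?_ ?_
    (den_dilate_inv_gauge ha hN ▸ rotSq_dilate_inv_gauge_ne_zero hN hS)
  · simp only [rotSq_dilate]
    fun_prop
  · simp only [den, rotSq_dilate, gaugeFour_dilate]
    fun_prop

end UnitSphere

theorem ofReal_le_liminf_lintegral_collarDensity (ha : 0 ≤ a) {p : Space n m} (hN : 0 < gauge a p)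
    (hS : G.rotSq p ≠ 0) {ω : ℝ → ℝ}
    (hω : ContinuousWithinAt ω (Set.Ici (gauge a p)) (gauge a p)) :
    ENNReal.ofReal (ω (gauge a p) / (4 * gauge a p)) ≤
      liminf (fun k => ∫⁻ t in Set.Ioi (gauge a p), ENNReal.ofReal
        (ω t * (t⁻¹ ^ 2 * G.collarDensity a (cutoff k) (dilate t⁻¹ p)))) atTop := by
  set N := gauge a p with N_def
  set h : ℝ → ℝ := fun t =>
    t ^ 3 / (4 * N ^ 4) * (G.rotSq (dilate t⁻¹ p) / G.den a (dilate t⁻¹ p)) * ω t with h_def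
  have h_cont : ContinuousWithinAt h (Set.Ici N) N :=
    (ContinuousWithinAt.mul (by fun_prop)
      (continuousAt_rotSq_div_den_dilate_inv ha hN.ne' hS).continuousWithinAt).mul hω
  have h_at : h N = ω N / (4 * N) := by
    simp only [h_def]
    rw [den_dilate_inv_gauge ha hN.ne', div_self (rotSq_dilate_inv_gauge_ne_zero hN.ne' hS)]
    field_simp
  rw [← h_at]
  refine (ofReal_le_liminf_lintegral_Ioi
    (fun k t ht => hasDerivAt_cutoff_gaugeFour_dilate_inv (a := a) (isCutoff_cutoff k) p
      (hN.trans_le ht))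
    (fun k => ?_) (fun k t ht => ?_) (fun k => ?_) (fun β hβ => ?_) h_cont).trans_eq ?_
  · have deriv_cont : Continuous (deriv (cutoff k)) :=
      (isCutoff_cutoff k).contDiff.continuous_deriv le_rfl
    have ne_zero : ∀ t ∈ Set.Ici N, t ≠ 0 := fun t ht => (hN.trans_le ht).ne'
    simp only [gaugeFour_dilate]
    fun_prop (disch := simpa using ne_zero)
  · have t_pos : 0 < t := hN.trans_le ht
    have gaugeFour_nonneg := gaugeFour_nonneg ha p
    exact mul_nonneg (neg_nonneg.2 (isCutoff_cutoff k).antitone.deriv_nonpos) (by positivity)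
  · rw [gaugeFour_dilate_inv_gauge ha hN.ne']
    exact ((isCutoff_cutoff k).eventually_eq_zero le_rfl).self_of_nhds
  · refine eventually_cutoff_eq_one ?_
    rw [gaugeFour_dilate_inv ha]
    have β_pos : 0 < β := hN.trans hβ
    exact pow_lt_one₀ (by positivity) ((div_lt_one β_pos).2 hβ) four_ne_zero
  · refine congrArg (liminf · atTop) (funext fun k => ?_)
    refine setLIntegral_congr_fun measurableSet_Ioi fun t ht => congrArg ENNReal.ofReal ?_
    have t_pos : 0 < t := hN.trans ht
    simp only [h_def, collarDensity, ← gauge_pow_four ha p, ← N_def]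
    field_simp

end Collar

end StepTwoCarnot

theorem ae_apply_ne_zero {E F : Type*} [NormedAddCommGroup E] [NormedSpace ℝ E]
    [FiniteDimensional ℝ E] [MeasurableSpace E] [BorelSpace E] (μ : Measure E) [μ.IsAddHaarMeasure]
    [AddCommGroup F] [Module ℝ F] {T : E →ₗ[ℝ] F} (hT : T ≠ 0) : ∀ᵐ x ∂μ, T x ≠ 0 := by
  rw [ae_iff]
  exact measure_mono_null (fun x hx => not_not.1 hx)
    (Measure.addHaar_submodule μ (LinearMap.ker T) (mt LinearMap.ker_eq_top.1 hT))

namespace StepTwoCarnot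

variable {n m : ℕ} (G : StepTwoCarnot n m)

theorem exists_mulVec_ne_zero : ∃ j, ∀ᵐ x : EuclideanSpace ℝ (Fin n), G.Λ j *ᵥ x.ofLp ≠ 0 := by
  let j : Fin m := ⟨0, G.pos⟩
  let T : EuclideanSpace ℝ (Fin n) →ₗ[ℝ] (Fin n → ℝ) :=
    (G.Λ j).mulVecLin ∘ₗ (WithLp.linearEquiv 2 ℝ (Fin n → ℝ)).toLinearMap
  refine ⟨j, ae_apply_ne_zero (T := T) volume fun hT => G.indep.ne_zero j ?_⟩
  ext i l
  simpa [T] using congrFun (LinearMap.congr_fun hT (EuclideanSpace.single l 1)) i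

theorem ae_rotSq_ne_zero : ∀ᵐ p : Space n m, G.rotSq p ≠ 0 := by
  obtain ⟨j, hj⟩ := G.exists_mulVec_ne_zero
  rw [ae_iff]
  simp only [not_not]
  refine (Measure.measure_prod_null (isClosed_eq G.contDiff_rotSq.continuous
    continuous_const).measurableSet).2 ?_
  filter_upwards [hj] with x hx
  let T : EuclideanSpace ℝ (Fin m) →ₗ[ℝ] (Fin n → ℝ) :=
    ∑ k, (LinearMap.toSpanSingleton ℝ (Fin n → ℝ) (G.Λ k *ᵥ x.ofLp)) ∘ₗ
      (EuclideanSpace.proj k).toLinearMap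
  have T_apply z : T z = G.rot (x, z) := by
    simp [T, rot, pencil, Matrix.sum_mulVec, Matrix.smul_mulVec]
  have T_ne_zero : T ≠ 0 := fun hT => hx <| by
    simpa [T, Pi.single_apply] using LinearMap.congr_fun hT (EuclideanSpace.single j 1)
  refine measure_mono_null (fun z hz => ?_) (ae_iff.1 (ae_apply_ne_zero volume T_ne_zero))
  rw [Set.mem_ofPred_eq, not_not, T_apply]
  exact dotProduct_self_eq_zero.1 hz

end StepTwoCarnot

namespace StepTwoCarnot

variable {n m : ℕ} (G : StepTwoCarnot n m) {a q : ℝ} {f : Space n m → ℝ} {g : ℝ → ℝ}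

section GaugeBalls

theorem exists_lintegral_collarDensity_le (ha : 0 < a) (hq : 2 ≤ q) :
    ∃ C D : ℝ, 0 < C ∧ 0 < D ∧ ∀ κ, IsCutoff κ → ∀ t : ℝ, 1 ≤ t → ∀ f, G.LocLipschitz a f →
      ∫⁻ p, ENNReal.ofReal (t⁻¹ ^ 2 * G.collarDensity a κ (dilate t⁻¹ p) * |f p| ^ q) ≤
        ∫⁻ p, ENNReal.ofReal (κ (gaugeFour a (dilate t⁻¹ p)) *
          (C * ‖G.subgradient f p‖ ^ q + D * |f p| ^ q)) := by
  obtain ⟨W, ε, D, hε, hD, hW⟩ := G.exists_isBarrier ha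
  have : 0 < q := two_pos.trans_le hq
  refine ⟨q ^ 2 / (4 * ε), q ^ 2 / (4 * ε) + D, by positivity, by positivity,
    fun κ hκ t ht f hf => ?_⟩
  have t_pos : 0 < t := one_pos.trans_le ht
  exact lintegral_multiplier_le hf hq hε (hW.contDiff_dilate_cutoff hκ t⁻¹)
    (hasCompactSupport_cutoff_gaugeFour_dilate ha hκ (inv_pos.2 t_pos)) (fun p => hκ.nonneg _)
    (fun p => mul_nonneg (sq_nonneg _) (collarDensity_nonneg hκ _))
    (hW.exists_div_dilate_cutoff_le hD hκ (inv_nonneg.2 t_pos.le) (inv_le_one_of_one_le₀ ht))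

end GaugeBalls

section Measurability

variable {κ : ℝ → ℝ}

theorem measurable_subgradient (hf : Continuous f) : Measurable (G.subgradient f) := by
  refine (WithLp.measurable_toLp 2 _).comp (measurable_pi_lambda _ fun i => ?_)
  exact (measurable_lineDeriv_uncurry hf).comp
    (measurable_id.prodMk (G.contDiff_field (r := 0) i).continuous.measurable)

theorem measurable_collarDensity_dilate_inv (hκ : IsCutoff κ) (hf : Continuous f) :
    Measurable fun x : ℝ × Space n m =>
      ENNReal.ofReal (x.1⁻¹ ^ 2 * G.collarDensity a κ (dilate x.1⁻¹ x.2) * |f x.2| ^ q) := by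
  have collar := (G.measurable_collarDensity (a := a) hκ).comp measurable_dilate_inv
  have f_meas := hf.measurable
  fun_prop

theorem measurable_cutoff_dilate_inv (hκ : IsCutoff κ) (hf : Continuous f) (C D : ℝ) :
    Measurable fun x : ℝ × Space n m => ENNReal.ofReal (κ (gaugeFour a (dilate x.1⁻¹ x.2)) *
      (C * ‖G.subgradient f x.2‖ ^ q + D * |f x.2| ^ q)) := by
  have cutoff := (hκ.contDiff.continuous.comp
    (contDiff_gaugeFour (n := n) (m := m) a).continuous).measurable.comp measurable_dilate_inv
  have gradient_term : Measurable fun p => C * ‖G.subgradient f p‖ ^ q + D * |f p| ^ q :=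
    (((G.measurable_subgradient hf).norm.pow_const q).const_mul C).add
      ((hf.measurable.abs.pow_const q).const_mul D)
  exact (cutoff.mul (gradient_term.comp measurable_snd)).ennreal_ofReal

theorem aemeasurable_deriv_mul_exp_neg (hg : ContinuousOn g (Set.Ici 0)) :
    AEMeasurable (fun t => ENNReal.ofReal (deriv g t * Real.exp (-g t)))
      (volume.restrict (Set.Ioi 1)) := by
  have g_meas : AEMeasurable g (volume.restrict (Set.Ioi 1)) :=
    (hg.mono fun t ht => zero_le_one.trans (Set.mem_Ioi.1 ht).le).aemeasurable measurableSet_Ioi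
  exact ((measurable_deriv g).aemeasurable.mul g_meas.neg.exp).ennreal_ofReal

end Measurability

section Layers

theorem lintegral_Ioi_deriv_mul_exp_neg_mul_cutoff_le (ha : 0 ≤ a)
    (hg_mono : MonotoneOn g (Set.Ici 0)) (hg_diff : DifferentiableOn ℝ g (Set.Ici 0)) (k : ℕ)
    (p : Space n m) {R : ℝ} (hR : 0 ≤ R) :
    ∫⁻ t in Set.Ioi 1, ENNReal.ofReal (deriv g t * Real.exp (-g t)) *
        ENNReal.ofReal (cutoff k (gaugeFour a (dilate t⁻¹ p)) * R) ≤
      ENNReal.ofReal (Real.exp (-g (gauge a p))) * ENNReal.ofReal R := by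
  set M := max 1 (gauge a p)
  have M_pos : 0 < M := one_pos.trans_le (le_max_left _ _)
  calc _ ≤ ∫⁻ t in Set.Ioi 1, (Set.Ioi M).indicator
          (fun t => ENNReal.ofReal (deriv g t * Real.exp (-g t))) t * ENNReal.ofReal R := by
        refine setLIntegral_mono' measurableSet_Ioi fun t ht => ?_
        rcases lt_or_ge M t with outside | inside
        · rw [Set.indicator_of_mem (Set.mem_Ioi.2 outside)]
          gcongr
          exact mul_le_of_le_one_left hR (cutoff_le_one k _)
        · have t_le : t ≤ gauge a p := (le_max_iff.1 inside).resolve_left (not_le.2 ht)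
          have one_le : 1 ≤ gaugeFour a (dilate t⁻¹ p) := by
            rw [gaugeFour_dilate_inv ha]
            exact one_le_pow₀ ((one_le_div (one_pos.trans ht)).2 t_le)
          rw [((isCutoff_cutoff k).eventually_eq_zero one_le).self_of_nhds]
          simp
    _ = (∫⁻ t in Set.Ioi M, ENNReal.ofReal (deriv g t * Real.exp (-g t))) *
          ENNReal.ofReal R := by
        rw [lintegral_mul_const' _ _ ENNReal.ofReal_ne_top, setLIntegral_indicator
          measurableSet_Ioi, Set.inter_eq_left.2 (Set.Ioi_subset_Ioi (le_max_left _ _))]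
    _ ≤ _ := by
        gcongr
        refine (lintegral_Ioi_deriv_mul_exp_neg_le hg_mono hg_diff M_pos).trans ?_
        gcongr
        exact hg_mono (gauge_nonneg ha p) M_pos.le (le_max_right _ _)

theorem ofReal_le_liminf_lintegral_Ioi_collarDensity (ha : 0 ≤ a) {ω : ℝ → ℝ} {y : ℝ}
    (hω : ContinuousOn ω (Set.Ici 1)) (ω_nonneg : ∀ t, 1 ≤ t → 0 ≤ ω t) {p : Space n m}
    (hN : 1 ≤ gauge a p) (hS : G.rotSq p ≠ 0) :
    ENNReal.ofReal (ω (gauge a p) / (4 * gauge a p) * y) ≤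
      liminf (fun k => ∫⁻ t in Set.Ioi 1, ENNReal.ofReal (ω t) *
        ENNReal.ofReal (t⁻¹ ^ 2 * G.collarDensity a (cutoff k) (dilate t⁻¹ p) * y)) atTop := by
  have peak := G.ofReal_le_liminf_lintegral_collarDensity ha (one_pos.trans_le hN) hS
    (ω := fun t => ω t * y)
    (((hω _ hN).mono (Set.Ici_subset_Ici.2 hN)).mul continuousWithinAt_const)
  rw [div_mul_eq_mul_div]
  refine peak.trans (liminf_le_liminf (Eventually.of_forall fun k => ?_))
  calc _ = ∫⁻ t in Set.Ioi (gauge a p), ENNReal.ofReal (ω t) *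
          ENNReal.ofReal (t⁻¹ ^ 2 * G.collarDensity a (cutoff k) (dilate t⁻¹ p) * y) := by
        refine setLIntegral_congr_fun measurableSet_Ioi fun t ht => ?_
        simp only [← ENNReal.ofReal_mul (ω_nonneg t (hN.trans (Set.mem_Ioi.1 ht).le))]
        ring_nf
    _ ≤ _ := lintegral_mono_set (Set.Ioi_subset_Ioi hN)

theorem exists_lintegral_lintegral_collarDensity_le (ha : 0 < a)
    (hg_mono : MonotoneOn g (Set.Ici 0)) (hg_diff : DifferentiableOn ℝ g (Set.Ici 0))
    (hq : 2 ≤ q) :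
    ∃ C D : ℝ, 0 < C ∧ 0 < D ∧ ∀ f, G.LocLipschitz a f → ∀ k,
      ∫⁻ p, ∫⁻ t in Set.Ioi 1, ENNReal.ofReal (deriv g t * Real.exp (-g t)) * ENNReal.ofReal
          (t⁻¹ ^ 2 * G.collarDensity a (cutoff k) (dilate t⁻¹ p) * |f p| ^ q) ≤
        ∫⁻ p, ENNReal.ofReal (Real.exp (-g (gauge a p))) *
          ENNReal.ofReal (C * ‖G.subgradient f p‖ ^ q + D * |f p| ^ q) := by
  obtain ⟨C, D, hC, hD, collar_le⟩ := G.exists_lintegral_collarDensity_le ha hq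
  refine ⟨C, D, hC, hD, fun f hf k => ?_⟩
  refine (lintegral_lintegral_mul_mono (aemeasurable_deriv_mul_exp_neg hg_diff.continuousOn)
    (G.measurable_collarDensity_dilate_inv (isCutoff_cutoff k) hf.continuous)
    (G.measurable_cutoff_dilate_inv (isCutoff_cutoff k) hf.continuous C D)
    ((ae_restrict_mem measurableSet_Ioi).mono fun t ht =>
      collar_le _ (isCutoff_cutoff k) t (Set.mem_Ioi.1 ht).le f hf)).trans ?_
  exact lintegral_mono fun p =>
    lintegral_Ioi_deriv_mul_exp_neg_mul_cutoff_le ha.le hg_mono hg_diff k p (by positivity)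

theorem exists_lintegral_deriv_mul_exp_neg_le (ha : 0 < a) (hg_mono : MonotoneOn g (Set.Ici 0))
    (hg_diff : DifferentiableOn ℝ g (Set.Ici 0)) (hg_cont : ContinuousOn (deriv g) (Set.Ici 1))
    (hq : 2 ≤ q) :
    ∃ C D : ℝ, 0 < C ∧ 0 < D ∧ ∀ f, G.LocLipschitz a f → (∀ p, gauge a p < 1 → f p = 0) →
      ∫⁻ p, ENNReal.ofReal (deriv g (gauge a p) * Real.exp (-g (gauge a p)) / (4 * gauge a p) *
          |f p| ^ q) ≤
        ∫⁻ p, ENNReal.ofReal (Real.exp (-g (gauge a p))) *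
          ENNReal.ofReal (C * ‖G.subgradient f p‖ ^ q + D * |f p| ^ q) := by
  obtain ⟨C, D, hC, hD, layers_le⟩ :=
    G.exists_lintegral_lintegral_collarDensity_le ha hg_mono hg_diff hq
  refine ⟨C, D, hC, hD, fun f hf hf0 => ?_⟩
  set ω : ℝ → ℝ := fun t => deriv g t * Real.exp (-g t)
  have ω_cont : ContinuousOn ω (Set.Ici 1) :=
    hg_cont.mul (hg_diff.continuousOn.mono (Set.Ici_subset_Ici.2 zero_le_one)).neg.rexp
  have ω_nonneg t (ht : 1 ≤ t) : 0 ≤ ω t :=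
    mul_nonneg (deriv_nonneg_of_monotoneOn_Ici hg_mono (one_pos.trans_le ht)) (Real.exp_pos _).le
  set I : ℕ → Space n m → ENNReal := fun k p => ∫⁻ t in Set.Ioi 1, ENNReal.ofReal (ω t) *
    ENNReal.ofReal (t⁻¹ ^ 2 * G.collarDensity a (cutoff k) (dilate t⁻¹ p) * |f p| ^ q)
  have I_meas k : AEMeasurable (I k) :=
    ((aemeasurable_deriv_mul_exp_neg hg_diff.continuousOn).comp_snd.mul
      ((G.measurable_collarDensity_dilate_inv (isCutoff_cutoff k)
        hf.continuous).comp measurable_swap).aemeasurable).lintegral_prod_right'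
  calc _ ≤ ∫⁻ p, liminf (fun k => I k p) atTop := by
        refine lintegral_mono_ae (G.ae_rotSq_ne_zero.mono fun p hp => ?_)
        rcases lt_or_ge (gauge a p) 1 with inside | outside
        · simp [hf0 p inside, Real.zero_rpow (two_pos.trans_le hq).ne']
        · exact G.ofReal_le_liminf_lintegral_Ioi_collarDensity ha.le ω_cont ω_nonneg outside hp
    _ ≤ liminf (fun k => ∫⁻ p, I k p) atTop := lintegral_liminf_le' I_meas
    _ ≤ _ := liminf_le_of_frequently_le' (Frequently.of_forall (layers_le f hf))

end Layers

end StepTwoCarnot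

namespace StepTwoCarnot

variable {n m : ℕ} {a q : ℝ} {f : Space n m → ℝ} {g : ℝ → ℝ}

section Weight

/-- The measure `e^{-g(N)} dλ`, which is `gibbs` without the normalisation by `Z`; no integrability
is needed for it to be meaningful. -/
noncomputable def weight (n m : ℕ) (a : ℝ) (g : ℝ → ℝ) : Measure (Space n m) :=
  volume.withDensity fun p => ENNReal.ofReal (Real.exp (-g (gauge a p)))

theorem measurable_exp_neg_gauge (ha : 0 ≤ a) (hg : ContinuousOn g (Set.Ici 0)) :
    Measurable fun p : Space n m => ENNReal.ofReal (Real.exp (-g (gauge a p))) :=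
  (hg.comp_continuous (continuous_gauge a) (gauge_nonneg ha)).neg.rexp.measurable.ennreal_ofReal

theorem lintegral_weight (ha : 0 ≤ a) (hg : ContinuousOn g (Set.Ici 0)) (u : Space n m → ENNReal) :
    ∫⁻ p, u p ∂weight n m a g =
      ∫⁻ p, ENNReal.ofReal (Real.exp (-g (gauge a p))) * u p :=
  lintegral_withDensity_eq_lintegral_mul_non_measurable _ (measurable_exp_neg_gauge ha hg)
    (Eventually.of_forall fun _ => ENNReal.ofReal_lt_top) u

theorem gibbs_eq_smul_weight (ha : 0 ≤ a) (hg : ContinuousOn g (Set.Ici 0)) :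
    gibbs n m a g =
      ENNReal.ofReal (∫ p : Space n m, Real.exp (-g (gauge a p)))⁻¹ • weight n m a g := by
  rw [weight, ← withDensity_smul _ (measurable_exp_neg_gauge ha hg), gibbs]
  congr 1
  funext p
  rw [Pi.smul_apply, smul_eq_mul, ← ENNReal.ofReal_mul' (Real.exp_pos _).le, inv_mul_eq_div]

theorem lintegral_gibbs_le_of_weight (ha : 0 ≤ a) (hg : ContinuousOn g (Set.Ici 0))
    {u u' v w : Space n m → ENNReal} (hu : ∀ p, u p ≤ u' p) {C D : ENNReal}
    (h : ∫⁻ p, u' p ∂weight n m a g ≤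
      C * ∫⁻ p, v p ∂weight n m a g + D * ∫⁻ p, w p ∂weight n m a g) :
    ∫⁻ p, u p ∂gibbs n m a g ≤
      C * ∫⁻ p, v p ∂gibbs n m a g + D * ∫⁻ p, w p ∂gibbs n m a g := by
  simp only [gibbs_eq_smul_weight ha hg, lintegral_smul_measure, smul_eq_mul, mul_left_comm C,
    mul_left_comm D]
  rw [← mul_add]
  gcongr
  exact (lintegral_mono hu).trans h

end Weight

theorem deriv_div_gauge_sq_mul_le (hg : MonotoneOn g (Set.Ici 0)) (hq : q ≠ 0)
    (hf : ∀ p, gauge a p < 1 → f p = 0) (p : Space n m) :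
    deriv g (gauge a p) / gauge a p ^ 2 * |f p| ^ q ≤
      deriv g (gauge a p) / gauge a p * |f p| ^ q := by
  rcases lt_or_ge (gauge a p) 1 with inside | outside
  · simp [hf p inside, Real.zero_rpow hq]
  · have deriv_nonneg := deriv_nonneg_of_monotoneOn_Ici hg (one_pos.trans_le outside)
    gcongr
    exact le_self_pow₀ outside two_ne_zero

end StepTwoCarnot

theorem theorem1_general {n m : ℕ} (G : StepTwoCarnot n m) {a : ℝ} (ha : 0 < a) {g : ℝ → ℝ}
    (hg_mono : MonotoneOn g (Set.Ici 0)) (hg_diff : DifferentiableOn ℝ g (Set.Ici 0))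
    (hg_cont : ContinuousOn (deriv g) (Set.Ici 1)) {q : ℝ} (hq : 2 ≤ q) :
    ∃ C D : ℝ, 0 < C ∧ 0 < D ∧
      ∀ f : StepTwoCarnot.Space n m → ℝ,
        G.LocLipschitz a f →
        (∀ p, StepTwoCarnot.gauge a p < 1 → f p = 0) →
        ∫⁻ p, ENNReal.ofReal
            (deriv g (StepTwoCarnot.gauge a p) / StepTwoCarnot.gauge a p * |f p| ^ q)
            ∂(StepTwoCarnot.weight n m a g) ≤
          ENNReal.ofReal C *
              ∫⁻ p, ENNReal.ofReal (‖G.subgradient f p‖ ^ q) ∂(StepTwoCarnot.weight n m a g) +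
            ENNReal.ofReal D *
              ∫⁻ p, ENNReal.ofReal (|f p| ^ q) ∂(StepTwoCarnot.weight n m a g) := by
  obtain ⟨C, D, hC, hD, le⟩ :=
    G.exists_lintegral_deriv_mul_exp_neg_le ha hg_mono hg_diff hg_cont hq
  refine ⟨4 * C, 4 * D, by positivity, by positivity, fun f hf hf0 => ?_⟩
  have f_meas : Measurable fun p => ENNReal.ofReal (|f p| ^ q) :=
    (hf.continuous.measurable.abs.pow_const q).ennreal_ofReal
  rw [← lintegral_const_mul' _ _ ENNReal.ofReal_ne_top,
    ← lintegral_const_mul' _ _ ENNReal.ofReal_ne_top, ← lintegral_add_right _ (f_meas.const_mul _)]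
  simp only [StepTwoCarnot.lintegral_weight ha.le hg_diff.continuousOn]
  calc _ = ENNReal.ofReal 4 * ∫⁻ p, ENNReal.ofReal (deriv g (StepTwoCarnot.gauge a p) *
          Real.exp (-g (StepTwoCarnot.gauge a p)) / (4 * StepTwoCarnot.gauge a p) * |f p| ^ q) := by
        rw [← lintegral_const_mul' _ _ ENNReal.ofReal_ne_top]
        refine lintegral_congr fun p => ?_
        rw [← ENNReal.ofReal_mul (Real.exp_pos _).le, ← ENNReal.ofReal_mul zero_le_four]
        congr 1
        ring
    _ ≤ _ := mul_le_mul_right (le f hf hf0) (ENNReal.ofReal 4)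
    _ = _ := by
        rw [← lintegral_const_mul' _ _ ENNReal.ofReal_ne_top]
        refine lintegral_congr fun p => ?_
        rw [mul_left_comm, ← ENNReal.ofReal_mul zero_le_four, mul_add, ← mul_assoc,
          ← mul_assoc, ENNReal.ofReal_add (by positivity) (by positivity),
          ENNReal.ofReal_mul (p := 4 * C) (by positivity),
          ENNReal.ofReal_mul (p := 4 * D) (by positivity)]

theorem theorem1 {n m : ℕ} (G : StepTwoCarnot n m) (a : ℝ) (ha : 0 < a) (g : ℝ → ℝ)
    (hg_nonneg : ∀ t, 0 ≤ t → 0 ≤ g t)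
    (hg_mono : MonotoneOn g (Set.Ici 0))
    (hg_diff : DifferentiableOn ℝ g (Set.Ici 0))
    (hg_diff' : DifferentiableOn ℝ (deriv g) (Set.Ici 1))
    (hg_growth : ∀ t, 1 ≤ t → derivWithin (deriv g) (Set.Ici 1) t ≤ deriv g t ^ 3 * t ^ 3)
    (hμ : IsProbabilityMeasure (StepTwoCarnot.gibbs n m a g))
    (q : ℝ) (hq : 2 ≤ q) :
    ∃ C D : ℝ, 0 < C ∧ 0 < D ∧
      ∀ f : StepTwoCarnot.Space n m → ℝ,
        G.LocLipschitz a f →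
        (∀ p, StepTwoCarnot.gauge a p < 1 → f p = 0) →
        ∫⁻ p, ENNReal.ofReal
            (deriv g (StepTwoCarnot.gauge a p) / StepTwoCarnot.gauge a p ^ 2 * |f p| ^ q)
            ∂(StepTwoCarnot.gibbs n m a g) ≤
          ENNReal.ofReal C *
              ∫⁻ p, ENNReal.ofReal (‖G.subgradient f p‖ ^ q) ∂(StepTwoCarnot.gibbs n m a g) +
            ENNReal.ofReal D *
              ∫⁻ p, ENNReal.ofReal (|f p| ^ q) ∂(StepTwoCarnot.gibbs n m a g) := by
  obtain ⟨C, D, hC, hD, le⟩ := theorem1_general G ha hg_mono hg_diff hg_diff'.continuousOn hq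
  exact ⟨C, D, hC, hD, fun f hf hf0 => StepTwoCarnot.lintegral_gibbs_le_of_weight ha.le
    hg_diff.continuousOn (fun p => ENNReal.ofReal_le_ofReal <|
      StepTwoCarnot.deriv_div_gauge_sq_mul_le hg_mono (by linarith) hf0 p) (le f hf hf0)⟩
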